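/- Setting. Fix integers $K\ge 1$, $M\ge 0$, a path-loss exponent $\eta>2$, a transmission probability $p_{tr}\in(0,1]$ with $q_{tr}=1-p_{tr}$, a density $\lambda>0$, densities $\lambda_m>0$, powers $P_m>0$ and transmission probabilities $p_{tr}^{(m)}\in[0,1]$ for $m=1,\dots,M$, and normalized distances $0<\omega_1<\dots<\omega_K=1$. Let $\Phi_0,\Phi_1,\dots,\Phi_M$ be independent homogeneous Poisson point processes in the plane with densities $\lambda,\lambda_1,\dots,\lambda_M$. Every node has a Bernoulli transmission indicator $\mathbb 1$ (success probability $p_{tr}$ for the $K$ serving transmitters and for $\Phi_0$, and $p_{tr}^{(m)}$ for $\Phi_m$) and an $\exp(1)$ fading power $H$; all these variables and the processes are mutually independent. For a user at the origin served by transmitters at distances $d_i=\omega_i d_K$ ($1\le i\le K$), and noise variance $\sigma^2\ge 0$, the SINR is $$\gamma=\frac{\sum_{i=1}^K \mathbb 1_i H_i d_i^{-\eta}}{I_0+\sum_{m=1}^M I_m+\sigma^2},\qquad I_0=\sum_{x\in\Phi_0,\ |x|>d_K}\mathbb 1_x H_x|x|^{-\eta},\qquad I_m=\sum_{x\in\Phi_m}\mathbb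 1_x P_m H_x|x|^{-\eta}.$$ For $\theta\ge0$ let $\bar F'_\gamma(K,\theta)$ be $\Pr[\gamma>\theta]$ for the given $d_K$, averaged over $d_K$, where $d_K$ is the distance from the origin to the $K$-th nearest point of a homogeneous Poisson point process of the effective transmitter density $p_{tr}\lambda$ (thus with the normalized geometry $\{\omega_i\}$ kept fixed). Theorem 2. The distance $d_K$ has the generalized Gamma density $$f_{d_K}(r)=\frac{2}{r\,\Gamma(K)}\,(p_{tr}\lambda\pi r^2)^K e^{-p_{tr}\lambda\pi r^2},\qquad r>0.$$ In the interference-limited regime, i.e. both for $\sigma^2=0$ and in the limit $\sigma^2\to0^+$, for every $\theta\ge 0$, $$\bar F'_\gamma(K,\theta)=\sum_{j=1}^K\frac{\sum_{i=0}^{K-1}\alpha_i(\Omega)\,(q_{tr}^i-q_{tr}^K)\,(\omega_j^\eta)^i}{\omega_j^\eta\prod_{l\ne j}(\omega_l^\eta-\omega_j^\eta)}\,\Bigl(1+\mathcal F(\omega_j^\eta\theta,\eta)+\Upsilon_j(M)\Bigr)^{-K},$$ where $\alpha_i(\Omega)=(-1)^i$ times the sum of all products of $K-i$ of the numbers $\omega_1^\eta,\dots,\omega_K^\eta$,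 $$\mathcal F(t_1,t_2)=\frac{2t_1}{t_2-2}\;{}_2F_1\Bigl(1,1-\tfrac2{t_2};2-\tfrac2{t_2};-t_1\Bigr),$$ $$\Upsilon_j(M)=\omega_j^2\,\theta^{2/\eta}\,\Gamma(1+\tfrac2\eta)\,\Gamma(1-\tfrac2\eta)\sum_{m=1}^M\frac{p_{tr}^{(m)}}{p_{tr}}\,\frac{\lambda_m}{\lambda}\,P_m^{2/\eta}.$$ If there are no extrinsic tiers ($M=0$), then $\bar F'_\gamma(K,\theta)$ at $\sigma^2=0$ does not depend on $\lambda$. -/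

import Mathlib

open MeasureTheory ProbabilityTheory
open scoped ENNReal NNReal

noncomputable section

/-- The Gauss hypergeometric function `₂F₁(a, b; c; z)` for real parameters `0 < b < c` and real
`z < 1`, given by Euler's integral
`Γ(c) / (Γ(b) Γ(c - b)) * ∫₀¹ t^(b-1) (1-t)^(c-b-1) (1-zt)^(-a) dt`.
On `|z| < 1` this is the sum of the hypergeometric series; for `z ≤ -1`, where the series diverges,
it is its analytic continuation along the negative axis. -/
def gauss2F1 (a b c z : ℝ) : ℝ :=
  Real.Gamma c / (Real.Gamma b * Real.Gamma (c - b)) *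
    ∫ t in (0 : ℝ)..1, t ^ (b - 1) * (1 - t) ^ (c - b - 1) * (1 - z * t) ^ (-a)

/-- Agreement with Mathlib's hypergeometric series inside the unit disc (for the parameters
`(1, b; b + 1)` that occur below). -/
theorem gauss2F1_eq_series {b z : ℝ} (hb : 0 < b) (hz : |z| < 1) :
    gauss2F1 1 b (b + 1) z = ordinaryHypergeometric (1 : ℝ) b (b + 1) z := by
  have hint : ∀ n : ℕ, ∫ t in Set.Ioc (0 : ℝ) 1, t ^ (b - 1 + n) = 1 / (b + n) := by
    intro n
    have hn : (0 : ℝ) ≤ n := Nat.cast_nonneg n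
    rw [← intervalIntegral.integral_of_le zero_le_one, integral_rpow (Or.inl (by linarith)),
      Real.one_rpow, Real.zero_rpow (by linarith)]
    congr 1 <;> ring
  have hii : ∀ n : ℕ, IntegrableOn (fun t : ℝ => t ^ (b - 1 + n)) (Set.Ioc 0 1) := by
    intro n
    have hn : (0 : ℝ) ≤ n := Nat.cast_nonneg n
    exact (intervalIntegrable_iff_integrableOn_Ioc_of_le zero_le_one).1
      (intervalIntegral.intervalIntegrable_rpow' (by linarith))
  have hs : HasSum (fun n : ℕ => ∫ t in Set.Ioc (0 : ℝ) 1, z ^ n * t ^ (b - 1 + n))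
      (∫ t in Set.Ioc (0 : ℝ) 1, ∑' n : ℕ, z ^ n * t ^ (b - 1 + n)) := by
    refine hasSum_integral_of_summable_integral_norm (fun n => (hii n).const_mul _) ?_
    have he : ∀ n : ℕ, ∫ t in Set.Ioc (0 : ℝ) 1, ‖z ^ n * t ^ (b - 1 + n)‖
        = |z| ^ n * (1 / (b + n)) := by
      intro n
      rw [← hint n, ← integral_const_mul]
      refine setIntegral_congr_fun measurableSet_Ioc fun t ht => ?_
      simp only [norm_mul, norm_pow, Real.norm_eq_abs]
      rw [abs_of_nonneg (Real.rpow_nonneg ht.1.le _)]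
    simp_rw [he]
    refine Summable.of_nonneg_of_le (fun n => by positivity) (fun n => ?_)
      ((summable_geometric_of_lt_one (abs_nonneg z) hz).mul_right (1 / b))
    gcongr
    have hn : (0 : ℝ) ≤ n := Nat.cast_nonneg n
    linarith
  have hpt : ∫ t in Set.Ioc (0 : ℝ) 1, ∑' n : ℕ, z ^ n * t ^ (b - 1 + n)
      = ∫ t in Set.Ioc (0 : ℝ) 1,
          t ^ (b - 1) * (1 - t) ^ (b + 1 - b - 1) * (1 - z * t) ^ (-1 : ℝ) := by
    refine setIntegral_congr_fun measurableSet_Ioc fun t ht => ?_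
    have h1 : ∀ n : ℕ, z ^ n * t ^ (b - 1 + n) = t ^ (b - 1) * (z * t) ^ n := by
      intro n
      rw [Real.rpow_add ht.1, Real.rpow_natCast, mul_pow]
      ring
    have h2 : |z * t| < 1 := by
      rw [abs_mul, abs_of_pos ht.1]
      nlinarith [abs_nonneg z, ht.1, ht.2]
    have h3 : b + 1 - b - 1 = 0 := by ring
    simp only [h1, h3, Real.rpow_zero, mul_one]
    rw [tsum_mul_left, tsum_geometric_of_abs_lt_one h2, Real.rpow_neg_one]
  have hG : Real.Gamma (b + 1) / (Real.Gamma b * Real.Gamma (b + 1 - b)) = b := by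
    rw [add_sub_cancel_left, Real.Gamma_one, Real.Gamma_add_one hb.ne']
    field_simp [(Real.Gamma_pos_of_pos hb).ne']
  have hP : ∀ n : ℕ, b * (ascPochhammer ℝ n).eval (b + 1)
      = (ascPochhammer ℝ n).eval b * (b + n) := by
    intro n
    have h := ascPochhammer_succ_left ℝ n
    have h' := ascPochhammer_succ_right ℝ n
    have := congrArg (Polynomial.eval b) (h.symm.trans h')
    simpa [Polynomial.eval_comp] using this
  unfold gauss2F1
  rw [hG, intervalIntegral.integral_of_le zero_le_one, ← hpt, ← hs.tsum_eq,
    ordinaryHypergeometric_eq_tsum, ← tsum_mul_left]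
  refine tsum_congr fun n => ?_
  have hn : (0 : ℝ) ≤ n := Nat.cast_nonneg n
  have hp : 0 < (ascPochhammer ℝ n).eval (b + 1) := ascPochhammer_pos n _ (by linarith)
  have hbn : b + n ≠ 0 := by linarith
  rw [integral_const_mul, hint n, ascPochhammer_eval_one, smul_eq_mul]
  have hf : ((n.factorial : ℕ) : ℝ) ≠ 0 := by positivity
  field_simp
  linear_combination z ^ n * hP n

/-! ### Poisson point processes -/

/-- The plane in which all nodes are located; the typical user sits at the origin. -/
abbrev Plane : Type := EuclideanSpace ℝ (Fin 2)

/-- The number of points of the enumerated configuration `x` that lie in `B`. -/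
def pointCount (x : ℕ → Plane) (B : Set Plane) : ℕ∞ := {n : ℕ | x n ∈ B}.encard

/-- The random points `X 0, X 1, …` form a homogeneous Poisson point process of density `ρ` in the
plane: the number of points in a measurable set of finite area `A` is Poisson with mean `ρ A`, and
the numbers of points in disjoint measurable sets are independent. -/
structure IsHomogeneousPPP {Ω : Type*} [MeasurableSpace Ω] (P : Measure Ω)
    (X : ℕ → Ω → Plane) (ρ : ℝ) : Prop where
  measurable : ∀ n, Measurable (X n)
  poisson : ∀ B : Set Plane, MeasurableSet B → volume B ≠ ⊤ → ∀ k : ℕ,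
    P {w | pointCount (fun n => X n w) B = k} =
      poissonMeasure (ρ * (volume B).toReal).toNNReal {k}
  indep : ∀ (N : ℕ) (B : Fin N → Set Plane), (∀ i, MeasurableSet (B i)) →
    Pairwise (fun i j => Disjoint (B i) (B j)) →
    iIndepFun (fun i w => pointCount (fun n => X n w) (B i)) P

/-- Distance from the origin to the `K`-th nearest point of the configuration `x`. -/
def kthNearest (K : ℕ) (x : ℕ → Plane) : ℝ :=
  sInf {r : ℝ | 0 ≤ r ∧ (K : ℕ∞) ≤ pointCount x (Metric.closedBall 0 r)}

/-! ### The network -/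

/-- Deterministic parameters of the network with cluster size `K` and `M` extrinsic tiers. -/
structure NetworkParams (K M : ℕ) where
  /-- path-loss exponent -/
  η : ℝ
  /-- transmission probability of every transmitter of the transmitter tier -/
  pTr : ℝ
  /-- density of the transmitter tier -/
  dens : ℝ
  /-- transmission probabilities of the extrinsic tiers -/
  tierPTr : Fin M → ℝ
  /-- densities of the extrinsic tiers -/
  tierDens : Fin M → ℝ
  /-- normalized transmit powers of the extrinsic tiers -/
  tierPow : Fin M → ℝ
  /-- normalized distances `ω_i = d_i / d_K` of the serving transmitters -/
  ω : Fin K → ℝ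

namespace NetworkParams

variable {K M : ℕ}

/-- Standing assumptions: path-loss exponent above `2`, positive densities and powers,
transmission probabilities in range, at least one serving transmitter, and normalized distances
`0 < ω_1 < ⋯ < ω_K = 1`. -/
structure Admissible (prm : NetworkParams K M) : Prop where
  η_gt : 2 < prm.η
  pTr_pos : 0 < prm.pTr
  pTr_le : prm.pTr ≤ 1
  dens_pos : 0 < prm.dens
  tierPTr_nonneg : ∀ m, 0 ≤ prm.tierPTr m
  tierPTr_le : ∀ m, prm.tierPTr m ≤ 1
  tierDens_pos : ∀ m, 0 < prm.tierDens m
  tierPow_pos : ∀ m, 0 < prm.tierPow m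
  K_pos : 0 < K
  ω_pos : ∀ i, 0 < prm.ω i
  ω_strictMono : StrictMono prm.ω
  ω_last : ∀ i : Fin K, (i : ℕ) + 1 = K → prm.ω i = 1

/-- Parameters of all `M + 1` tiers, the transmitter tier being tier `0`. -/
def allPTr (prm : NetworkParams K M) : Fin (M + 1) → ℝ := Fin.cons prm.pTr prm.tierPTr

/-- Densities of all `M + 1` tiers, the transmitter tier being tier `0`. -/
def allDens (prm : NetworkParams K M) : Fin (M + 1) → ℝ := Fin.cons prm.dens prm.tierDens

/-- Normalized powers of all `M + 1` tiers; the transmitter tier has unit power. -/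
def allPow (prm : NetworkParams K M) : Fin (M + 1) → ℝ := Fin.cons 1 prm.tierPow

end NetworkParams

/-- The random quantities of the network in one time slot: transmission indicators and fading power
gains of the `K` serving transmitters, and for each tier `m = 0, …, M` (tier `0` being the
transmitter tier) the locations of its nodes, their transmission indicators and fading power
gains. -/
structure Network (Ω : Type*) (K M : ℕ) where
  clusterOn : Fin K → Ω → Bool
  clusterFading : Fin K → Ω → ℝ
  points : Fin (M + 1) → ℕ → Ω → Plane
  on : Fin (M + 1) → ℕ → Ω → Bool
  fading : Fin (M + 1) → ℕ → Ω → ℝ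

/-- Labels for the mutually independent sources of randomness of a network. -/
inductive Source (K M : ℕ) where
  | clusterOn (i : Fin K)
  | clusterFading (i : Fin K)
  | points (m : Fin (M + 1))
  | on (m : Fin (M + 1)) (n : ℕ)
  | fading (m : Fin (M + 1)) (n : ℕ)

namespace Network

variable {Ω : Type*} {K M : ℕ}

/-- The σ-algebra generated by a source of randomness; all the locations of one tier together form
one source. -/
@[reducible] def sourceSigma (N : Network Ω K M) : Source K M → MeasurableSpace Ω
  | .clusterOn i => MeasurableSpace.comap (N.clusterOn i) inferInstance
  | .clusterFading i => MeasurableSpace.comap (N.clusterFading i) inferInstance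
  | .points m => ⨆ n, MeasurableSpace.comap (N.points m n) inferInstance
  | .on m n => MeasurableSpace.comap (N.on m n) inferInstance
  | .fading m n => MeasurableSpace.comap (N.fading m n) inferInstance

/-- The probabilistic model: independent homogeneous Poisson tiers, Bernoulli transmission
indicators, unit-mean exponential (Rayleigh) fading powers, everything mutually independent. -/
structure IsModel [MeasurableSpace Ω] (N : Network Ω K M) (P : Measure Ω)
    (prm : NetworkParams K M) : Prop where
  measurable_clusterOn : ∀ i, Measurable (N.clusterOn i)
  clusterOn_law : ∀ i, P {w | N.clusterOn i w = true} = ENNReal.ofReal prm.pTr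
  measurable_clusterFading : ∀ i, Measurable (N.clusterFading i)
  clusterFading_law : ∀ i, P.map (N.clusterFading i) = expMeasure 1
  points_law : ∀ m, IsHomogeneousPPP P (N.points m) (prm.allDens m)
  measurable_on : ∀ m n, Measurable (N.on m n)
  on_law : ∀ m n, P {w | N.on m n w = true} = ENNReal.ofReal (prm.allPTr m)
  measurable_fading : ∀ m n, Measurable (N.fading m n)
  fading_law : ∀ m n, P.map (N.fading m n) = expMeasure 1
  indep : iIndep N.sourceSigma P

/-- Received signal power when the serving transmitters are at distances `d_i`. -/
def signal (N : Network Ω K M) (η : ℝ) (d : Fin K → ℝ) (w : Ω) : ℝ≥0∞ :=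
  ∑ i, if N.clusterOn i w = true then
    ENNReal.ofReal (d i ^ (-η) * N.clusterFading i w) else 0

open Classical in
/-- Intrinsic interference: nodes of the transmitter tier outside the cluster, that is, farther
away than every serving transmitter. -/
def intrinsic (N : Network Ω K M) (η : ℝ) (d : Fin K → ℝ) (w : Ω) : ℝ≥0∞ :=
  ∑' n, if N.on 0 n w = true ∧ ∀ i, d i < ‖N.points 0 n w‖ then
    ENNReal.ofReal (‖N.points 0 n w‖ ^ (-η) * N.fading 0 n w) else 0

/-- Extrinsic interference from the `M` additional tiers (no guard zone). -/
def extrinsic (N : Network Ω K M) (prm : NetworkParams K M) (w : Ω) : ℝ≥0∞ :=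
  ∑ m : Fin M, ∑' n, if N.on m.succ n w = true then
    ENNReal.ofReal (prm.tierPow m * ‖N.points m.succ n w‖ ^ (-prm.η) * N.fading m.succ n w) else 0

/-- The signal-to-interference-plus-noise ratio at the typical user, with noise variance `σ2`. -/
def sinr (N : Network Ω K M) (prm : NetworkParams K M) (σ2 : ℝ) (d : Fin K → ℝ) (w : Ω) : ℝ≥0∞ :=
  N.signal prm.η d w / (N.intrinsic prm.η d w + N.extrinsic prm w + ENNReal.ofReal σ2)

/-- The CCDF of the SINR at `θ`, for a given absolute cluster geometry `d_1, …, d_K`. -/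
def linkCCDF [MeasurableSpace Ω] (N : Network Ω K M) (P : Measure Ω) (prm : NetworkParams K M)
    (σ2 : ℝ) (d : Fin K → ℝ) (θ : ℝ) : ℝ≥0∞ :=
  P {w | ENNReal.ofReal θ < N.sinr prm σ2 d w}

/-- The CCDF of the SINR at `θ` for the normalized cluster geometry `ω_1, …, ω_K`: the CCDF for the
geometry `d_i = ω_i d_K`, averaged over the distance `d_K` from the user to the `K`-th nearest point
of the random configuration `Y`. -/
def avgCCDF [MeasurableSpace Ω] (N : Network Ω K M) (P : Measure Ω) (prm : NetworkParams K M)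
    {Ω' : Type*} [MeasurableSpace Ω'] (Y : ℕ → Ω' → Plane) (P' : Measure Ω')
    (σ2 θ : ℝ) : ℝ :=
  (∫⁻ w', N.linkCCDF P prm σ2 (fun i => prm.ω i * kthNearest K (fun n => Y n w')) θ ∂P').toReal

end Network

/-! ### The closed form -/

/-- The generalized Gamma density of the distance to the `K`-th nearest transmitter, for effective
transmitter density `ρ`. -/
def distDensity (K : ℕ) (ρ r : ℝ) : ℝ :=
  if 0 < r then
    2 / (r * Real.Gamma K) * (ρ * Real.pi * r ^ 2) ^ K * Real.exp (-(ρ * Real.pi * r ^ 2))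
  else 0

/-- `F(t₁, t₂) = 2 t₁ / (t₂ - 2) * ₂F₁(1, 1 - 2/t₂; 2 - 2/t₂; -t₁)`. -/
def hyperF (t₁ t₂ : ℝ) : ℝ :=
  2 * t₁ / (t₂ - 2) * gauss2F1 1 (1 - 2 / t₂) (2 - 2 / t₂) (-t₁)

namespace NetworkParams

variable {K M : ℕ}

/-- `α_i(Ω) = (-1)^i` times the sum of all products of `K - i` of the `ω_l ^ η`, `l = 1, …, K`. -/
def alpha (prm : NetworkParams K M) (i : ℕ) : ℝ :=
  (-1) ^ i * ∑ s ∈ Finset.powersetCard (K - i) (Finset.univ : Finset (Fin K)),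
    ∏ l ∈ s, prm.ω l ^ prm.η

/-- The coefficient of the `j`-th term of the closed form, with `q = 1 - p`. -/
def coeff (prm : NetworkParams K M) (j : Fin K) : ℝ :=
  (∑ i ∈ Finset.range K,
      prm.alpha i * ((1 - prm.pTr) ^ i - (1 - prm.pTr) ^ K) * (prm.ω j ^ prm.η) ^ i) /
    (prm.ω j ^ prm.η * ∏ l ∈ Finset.univ.erase j, (prm.ω l ^ prm.η - prm.ω j ^ prm.η))

/-- The contribution `Υ_j(M)` of the extrinsic tiers. -/
def upsilon (prm : NetworkParams K M) (θ : ℝ) (j : Fin K) : ℝ :=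
  prm.ω j ^ 2 * θ ^ (2 / prm.η) * Real.Gamma (1 + 2 / prm.η) * Real.Gamma (1 - 2 / prm.η) *
    ∑ m, (prm.tierPTr m / prm.pTr) * (prm.tierDens m / prm.dens) * prm.tierPow m ^ (2 / prm.η)

/-- The closed form of the averaged CCDF. -/
def closedForm (prm : NetworkParams K M) (θ : ℝ) : ℝ :=
  ∑ j, prm.coeff j *
    ((1 + hyperF (prm.ω j ^ prm.η * θ) prm.η + prm.upsilon θ j) ^ K)⁻¹

end NetworkParams

end

/-! Fix `d_K = r`. The event `γ > θ` reads `S > θ (I + σ²)`, where the signal `S` is independent of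
the total interference `I`. Since `S` is a sum of Bernoulli-switched exponentials with distinct
rates `a_j = (ω_j r)^η`, its tail is a finite mixture `∑ c_j exp(-a_j x)` (`signal_tail`; the `c_j`
come from a partial fraction expansion). Conditioning on `I` turns the coverage probability into `∑
c_j exp(-a_j θ σ²) E[exp(-a_j θ I)]` (`linkCCDF_eq`).

For the Laplace transforms (`laplace_interference`), averaging over the fading and the indicator of
a node of weight `w` leaves the factor `1 - p w/(1+w)`, and the Laplace functional of a Poisson
process (`IsHomogeneousPPP.laplace`) then gives `exp(-λ p ∫ w/(1+w))` for each tier. In polar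
coordinates the tier with a guard zone produces the hypergeometric term and the other tiers produce
a product of Gamma values. By scaling, both are proportional to `r²`, so the exponent is `p_tr λ π
r² (F + Υ_j)`.

The `c_j` are invariant under scaling of the rates, hence depend only on `ω`; since the `α_i` are
the coefficients of `∏ (ω_l^η - y)`, they are the coefficients of the closed form (`coeff_eq`).
Without noise, `r` therefore enters only through `exp(-p_tr λ π r² C_j)`. Almost surely `d_K > r`
means that the disc of radius `r` holds fewer than `K` points, so the density of `d_K` is minus the
derivative of a Poisson tail (`map_kthNearest`). Thus `p_tr λ π d_K²` is Gamma distributed with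
shape `K`, and the average of each exponential is `(1 + C_j)^(-K)`.

Vanishing noise is dominated convergence. For `M = 0` the density no longer occurs in the closed
form. Working with `exp(-y)` on `[0, ∞]` lets the Laplace identities hold before the interference is
known to be finite. -/

noncomputable section

open Filter Topology

/-! ### The kernel `exp (-y)` on `[0, ∞]` -/

/-- `exp (-y)` for `y ∈ [0, ∞]`, with `exp (-∞) = 0`. -/
def expNeg (y : ℝ≥0∞) : ℝ≥0∞ := EReal.exp (-(y : EReal))

lemma expNeg_ofReal {x : ℝ} (hx : 0 ≤ x) :
    expNeg (ENNReal.ofReal x) = ENNReal.ofReal (Real.exp (-x)) := by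
  rw [expNeg, EReal.coe_ennreal_ofReal, max_eq_left hx, ← EReal.coe_neg, EReal.exp_coe]

@[simp] lemma expNeg_zero : expNeg 0 = 1 := by simp [expNeg]

@[simp] lemma expNeg_top : expNeg ⊤ = 0 := by simp [expNeg]

lemma expNeg_add (x y : ℝ≥0∞) : expNeg (x + y) = expNeg x * expNeg y := by
  rw [expNeg, expNeg, expNeg, ← EReal.exp_add, EReal.coe_ennreal_add,
    EReal.neg_add (Or.inl (EReal.coe_ennreal_ne_bot _)) (Or.inr (EReal.coe_ennreal_ne_bot _)),
    sub_eq_add_neg]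

lemma expNeg_sum {ι : Type*} (s : Finset ι) (f : ι → ℝ≥0∞) :
    expNeg (∑ i ∈ s, f i) = ∏ i ∈ s, expNeg (f i) := by
  classical
  induction s using Finset.induction_on with
  | empty => simp
  | insert a s ha ih => rw [Finset.sum_insert ha, Finset.prod_insert ha, expNeg_add, ih]

lemma expNeg_antitone : Antitone expNeg := fun _ _ h =>
  EReal.exp_monotone (EReal.neg_le_neg_iff.2 (EReal.coe_ennreal_le_coe_ennreal_iff.2 h))

lemma expNeg_le_one (y : ℝ≥0∞) : expNeg y ≤ 1 := expNeg_zero ▸ expNeg_antitone (zero_le (a := y))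

lemma continuous_expNeg : Continuous expNeg :=
  ENNReal.continuous_exp.comp (continuous_neg.comp continuous_coe_ennreal_ereal)

@[fun_prop] lemma measurable_expNeg : Measurable expNeg := continuous_expNeg.measurable

/-- Dominated convergence with the constant bound 1; this is how truncated sums over nodes are
replaced by full ones. -/
lemma tendsto_lintegral_expNeg {Ω : Type*} [MeasurableSpace Ω] {P : Measure Ω}
    [IsFiniteMeasure P] {F : ℕ → Ω → ℝ≥0∞} {f : Ω → ℝ≥0∞} (hF : ∀ n, Measurable (F n))
    (h : ∀ w, Tendsto (fun n => F n w) atTop (𝓝 (f w))) :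
    Tendsto (fun n => ∫⁻ w, expNeg (F n w) ∂P) atTop (𝓝 (∫⁻ w, expNeg (f w) ∂P)) :=
  tendsto_lintegral_of_dominated_convergence (fun _ => 1)
    (fun n => measurable_expNeg.comp (hF n))
    (fun n => Eventually.of_forall fun w => expNeg_le_one _) (by simp)
    (Eventually.of_forall fun w => (continuous_expNeg.tendsto _).comp (h w))

/-! ### The Laplace functional of a Poisson point process -/

lemma toENNReal_pointCount (x : ℕ → Plane) (B : Set Plane) :
    ((pointCount x B : ℕ∞) : ℝ≥0∞) = ∑' n, B.indicator (fun _ => (1 : ℝ≥0∞)) (x n) := by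
  rw [pointCount, ← ENNReal.tsum_set_one, tsum_subtype _ (fun _ => (1 : ℝ≥0∞))]
  rfl

/-- The probability generating function of the Poisson distribution. -/
lemma lintegral_expNeg_poissonMeasure (μ : ℝ≥0) (c : ℝ≥0) :
    ∫⁻ k : ℕ, expNeg (c * k) ∂(poissonMeasure μ) = expNeg (μ * (1 - expNeg c)) := by
  have hc : expNeg c = ENNReal.ofReal (Real.exp (-c)) := by
    rw [← expNeg_ofReal c.coe_nonneg, ENNReal.ofReal_coe_nnreal]
  have hR : expNeg (μ * (1 - expNeg c))
      = ENNReal.ofReal (Real.exp (-(μ * (1 - Real.exp (-c))))) := by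
    have h1 : (0 : ℝ) ≤ 1 - Real.exp (-c) := by
      have := Real.exp_le_one_iff.2 (neg_nonpos.2 c.coe_nonneg)
      linarith
    rw [← expNeg_ofReal (mul_nonneg μ.coe_nonneg h1), ENNReal.ofReal_mul μ.coe_nonneg, hc,
      ENNReal.ofReal_sub _ (Real.exp_pos _).le]
    simp
  rw [hR, lintegral_countable']
  have h2 : HasSum (fun k : ℕ => Real.exp (-μ) * ((μ * Real.exp (-c)) ^ k / k.factorial))
      (Real.exp (-(μ * (1 - Real.exp (-c))))) := by
    have := (NormedSpace.expSeries_div_hasSum_exp ((μ : ℝ) * Real.exp (-c))).mul_left (Real.exp (-μ))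
    rw [← Real.exp_eq_exp_ℝ, ← Real.exp_add] at this
    rwa [show -(μ : ℝ) + μ * Real.exp (-c) = -(μ * (1 - Real.exp (-c))) by ring] at this
  rw [← h2.tsum_eq, ENNReal.ofReal_tsum_of_nonneg (fun k => by positivity) h2.summable]
  refine tsum_congr fun k => ?_
  have h3 : (c : ℝ≥0∞) * k = ENNReal.ofReal (c * k) := by
    rw [ENNReal.ofReal_mul c.coe_nonneg]; simp
  rw [h3, expNeg_ofReal (by positivity), poissonMeasure_singleton,
    ← ENNReal.ofReal_mul (Real.exp_pos _).le]
  congr 1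
  rw [mul_pow, ← Real.exp_nat_mul]
  ring_nf

namespace IsHomogeneousPPP

variable {Ω : Type*} [MeasurableSpace Ω] {P : Measure Ω} {X : ℕ → Ω → Plane} {ρ : ℝ}

lemma measurable_tsum (h : IsHomogeneousPPP P X ρ) {f : Plane → ℝ≥0∞} (hf : Measurable f) :
    Measurable fun w => ∑' n, f (X n w) :=
  Measurable.tsum fun n => hf.comp (h.measurable n)

lemma measurable_pointCount (h : IsHomogeneousPPP P X ρ) {B : Set Plane} (hB : MeasurableSet B) :
    Measurable fun w => pointCount (fun n => X n w) B := by
  have h1 : Measurable fun w => ((pointCount (fun n => X n w) B : ℕ∞) : ℝ≥0∞) := by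
    simp_rw [toENNReal_pointCount]
    exact h.measurable_tsum (measurable_const.indicator hB)
  refine measurable_to_countable' fun k => ?_
  have : (fun w => pointCount (fun n => X n w) B) ⁻¹' {k}
      = (fun w => ((pointCount (fun n => X n w) B : ℕ∞) : ℝ≥0∞)) ⁻¹' {(k : ℝ≥0∞)} := by
    ext w; simp
  rw [this]
  exact h1 (measurableSet_singleton _)

/-- The model prescribes only the probabilities of finite counts. They already sum to one, so no
mass is left for the value `⊤`. -/
lemma map_pointCount [IsProbabilityMeasure P] (h : IsHomogeneousPPP P X ρ) {B : Set Plane}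
    (hB : MeasurableSet B) (hB' : volume B ≠ ⊤) :
    P.map (fun w => pointCount (fun n => X n w) B) =
      (poissonMeasure (ρ * (volume B).toReal).toNNReal).map (fun k : ℕ => (k : ℕ∞)) := by
  have hm := h.measurable_pointCount hB
  have hcast : Measurable (fun k : ℕ => (k : ℕ∞)) := measurable_of_countable _
  have hpre : ∀ k : ℕ, (fun k : ℕ => (k : ℕ∞)) ⁻¹' {(k : ℕ∞)} = {k} := fun k => by
    ext j; simp
  set Q := poissonMeasure (ρ * (volume B).toReal).toNNReal
  have : IsProbabilityMeasure (P.map fun w => pointCount (fun n => X n w) B) :=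
    Measure.isProbabilityMeasure_map hm.aemeasurable
  have hQ : IsProbabilityMeasure (Q.map fun k : ℕ => (k : ℕ∞)) :=
    Measure.isProbabilityMeasure_map hcast.aemeasurable
  have key : ∀ k : ℕ, P.map (fun w => pointCount (fun n => X n w) B) {(k : ℕ∞)}
      = Q.map (fun k : ℕ => (k : ℕ∞)) {(k : ℕ∞)} := by
    intro k
    rw [Measure.map_apply hm (measurableSet_singleton _),
      Measure.map_apply hcast (measurableSet_singleton _), hpre]
    exact h.poisson B hB hB' k
  -- On `ℕ∞`, a probability measure is determined by its masses at finite points.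
  have htop : ∀ R : Measure ℕ∞, IsProbabilityMeasure R → R {⊤} = 1 - ∑' k : ℕ, R {(k : ℕ∞)} := by
    intro R _
    have h1 : R (Set.range (fun k : ℕ => (k : ℕ∞))) = ∑' k : ℕ, R {(k : ℕ∞)} := by
      rw [← Set.iUnion_singleton_eq_range, measure_iUnion]
      · intro i j hij
        simpa [Function.onFun] using hij
      · exact fun _ => measurableSet_singleton _
    have h2 : ({⊤} : Set ℕ∞) = (Set.range (fun k : ℕ => (k : ℕ∞)))ᶜ := by
      ext x
      induction x using ENat.recTopCoe <;> simp
    rw [h2, prob_compl_eq_one_sub (MeasurableSet.of_discrete), h1]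
  refine Measure.ext_of_singleton fun k => ?_
  induction k using ENat.recTopCoe with
  | top => rw [htop _ this, htop _ hQ]; simp_rw [key]
  | coe k => exact key k

/-- The case `c = 0` admits sets of infinite area, needed for the zero level set of a simple
function; both sides are then 1 because `0 * ⊤ = 0`. -/
lemma lintegral_expNeg_pointCount [IsProbabilityMeasure P] (h : IsHomogeneousPPP P X ρ)
    {B : Set Plane} (hB : MeasurableSet B) {c : ℝ≥0∞} (hc : c ≠ ⊤) (hB' : c = 0 ∨ volume B ≠ ⊤) :
    ∫⁻ w, expNeg (c * (pointCount (fun n => X n w) B : ℕ∞)) ∂P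
      = expNeg (ENNReal.ofReal ρ * ((1 - expNeg c) * volume B)) := by
  rcases eq_or_ne c 0 with rfl | hc0
  · simp
  have hB'' := hB'.resolve_left hc0
  lift c to ℝ≥0 using hc
  have hcast : Measurable (fun k : ℕ => (k : ℕ∞)) := measurable_of_countable _
  have hmeas : Measurable fun k : ℕ∞ => expNeg (c * (k : ℝ≥0∞)) := measurable_of_countable _
  rw [← lintegral_map hmeas (h.measurable_pointCount hB), h.map_pointCount hB hB'',
    lintegral_map hmeas hcast]
  simp only [ENat.toENNReal_coe]
  rw [lintegral_expNeg_poissonMeasure]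
  congr 1
  rw [← ENNReal.ofReal, ENNReal.ofReal_mul' ENNReal.toReal_nonneg, ENNReal.ofReal_toReal hB'']
  ring

/-- The level sets of `f` are disjoint, so their point counts are independent, and the expectation
factors into Poisson generating functions. -/
lemma laplace_simpleFunc [IsProbabilityMeasure P] (h : IsHomogeneousPPP P X ρ)
    (f : SimpleFunc Plane ℝ≥0∞) (hf : ∀ x, f x ≠ ⊤) (hf' : ∀ c ≠ 0, volume (f ⁻¹' {c}) ≠ ⊤) :
    ∫⁻ w, expNeg (∑' n, f (X n w)) ∂P
      = expNeg (ENNReal.ofReal ρ * ∫⁻ x, 1 - expNeg (f x)) := by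
  classical
  set e := f.range.equivFin.symm
  set B : Fin f.range.card → Set Plane := fun i => f ⁻¹' {(e i : ℝ≥0∞)}
  have hB : ∀ i, MeasurableSet (B i) := fun i => f.measurableSet_preimage _
  have hdisj : Pairwise fun i j => Disjoint (B i) (B j) := by
    intro i j hij
    rw [Set.disjoint_left]
    intro x hx hx'
    simp only [B, Set.mem_preimage, Set.mem_singleton_iff] at hx hx'
    exact hij (e.injective (Subtype.ext (hx.symm.trans hx')))
  have hsum : ∀ w, ∑' n, f (X n w)
      = ∑ i, (e i : ℝ≥0∞) * (pointCount (fun n => X n w) (B i) : ℕ∞) := by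
    intro w
    simp_rw [toENNReal_pointCount, ← ENNReal.tsum_mul_left]
    rw [← Summable.tsum_finsetSum (fun _ _ => ENNReal.summable)]
    refine tsum_congr fun n => ?_
    obtain ⟨i, hi⟩ := e.surjective ⟨f (X n w), f.mem_range_self _⟩
    rw [Finset.sum_eq_single i]
    · have : X n w ∈ B i := by simp [B, hi]
      rw [Set.indicator_of_mem this, hi, mul_one]
    · intro j _ hj
      have : X n w ∉ B j := by
        intro hx
        simp only [B, Set.mem_preimage, Set.mem_singleton_iff] at hx
        exact hj (e.injective (Subtype.ext (by rw [hi]; exact hx.symm)))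
      rw [Set.indicator_of_notMem this, mul_zero]
    · simp
  have hne : ∀ i, (e i : ℝ≥0∞) ≠ ⊤ := by
    intro i
    obtain ⟨x, hx⟩ := SimpleFunc.mem_range.1 (e i).2
    rw [← hx]; exact hf x
  have hmeas : ∀ i, Measurable fun k : ℕ∞ => expNeg ((e i : ℝ≥0∞) * (k : ℝ≥0∞)) :=
    fun i => measurable_of_countable _
  have hind := (h.indep _ B hB hdisj).comp
    (fun i (k : ℕ∞) => expNeg ((e i : ℝ≥0∞) * (k : ℝ≥0∞))) hmeas
  simp_rw [hsum, expNeg_sum]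
  rw [lintegral_prod_eq_prod_lintegral_of_indepFun Finset.univ
    (fun i w => expNeg ((e i : ℝ≥0∞) * (pointCount (fun n => X n w) (B i) : ℕ∞))) hind
    (fun i => (hmeas i).comp (h.measurable_pointCount (hB i)))]
  have hint : ∫⁻ x, 1 - expNeg (f x)
      = ∑ i, (1 - expNeg (e i : ℝ≥0∞)) * volume (B i) := by
    have := SimpleFunc.map_lintegral (μ := (volume : Measure Plane))
      (fun y => 1 - expNeg y) f
    rw [← SimpleFunc.lintegral_eq_lintegral] at this
    rw [SimpleFunc.coe_map] at this
    simp only [Function.comp_def] at this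
    rw [this, ← Finset.sum_coe_sort, ← e.sum_comp]
  rw [hint, Finset.mul_sum, expNeg_sum]
  refine Finset.prod_congr rfl fun i _ => ?_
  refine h.lintegral_expNeg_pointCount (hB i) (hne i) ?_
  by_cases h0 : (e i : ℝ≥0∞) = 0
  · exact Or.inl h0
  · exact Or.inr (hf' _ h0)

/-- The Laplace functional of a homogeneous Poisson point process. -/
theorem laplace [IsProbabilityMeasure P] (h : IsHomogeneousPPP P X ρ)
    {f : Plane → ℝ≥0∞} (hf : Measurable f) :
    ∫⁻ w, expNeg (∑' n, f (X n w)) ∂P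
      = expNeg (ENNReal.ofReal ρ * ∫⁻ x, 1 - expNeg (f x)) := by
  -- Cutting off outside a ball of radius `k` gives the nonzero level sets finite area, while `g k`
  -- still increases to `f`.
  set g : ℕ → SimpleFunc Plane ℝ≥0∞ :=
    fun k => (SimpleFunc.eapprox f k).restrict (Metric.closedBall 0 k)
  have hg : ∀ k x, g k x
      = (Metric.closedBall (0 : Plane) k).indicator (SimpleFunc.eapprox f k) x :=
    fun k x => SimpleFunc.restrict_apply _ Metric.isClosed_closedBall.measurableSet x
  have hmono : ∀ x, Monotone fun k => g k x := by
    intro x j k hjk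
    simp only [hg]
    refine (Set.indicator_le_indicator (SimpleFunc.monotone_eapprox f hjk x)).trans ?_
    exact Set.indicator_le_indicator_of_subset
      (Metric.closedBall_subset_closedBall (Nat.cast_le.2 hjk)) (fun _ => zero_le) x
  have htend : ∀ x, Tendsto (fun k => g k x) atTop (𝓝 (f x)) := by
    intro x
    have h1 : Tendsto (fun k => SimpleFunc.eapprox f k x) atTop (𝓝 (f x)) := by
      rw [← SimpleFunc.iSup_eapprox_apply hf x]
      exact tendsto_atTop_iSup fun j k hjk => SimpleFunc.monotone_eapprox f hjk x
    refine h1.congr' ?_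
    filter_upwards [eventually_ge_atTop ⌈‖x‖⌉₊] with k hk
    rw [hg, Set.indicator_of_mem]
    simpa using (Nat.le_ceil _).trans (Nat.cast_le.2 hk)
  have hL : Tendsto (fun k => ∫⁻ w, expNeg (∑' n, g k (X n w)) ∂P) atTop
      (𝓝 (∫⁻ w, expNeg (∑' n, f (X n w)) ∂P)) := by
    refine tendsto_lintegral_expNeg (fun k => h.measurable_tsum (g k).measurable) fun w => ?_
    -- The sum over nodes is an integral against counting measure, so monotone convergence applies
    -- to it.
    have := lintegral_tendsto_of_tendsto_of_monotone (μ := Measure.count)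
      (f := fun k n => g k (X n w)) (F := fun n => f (X n w))
      (fun k => (measurable_of_countable _).aemeasurable)
      (Eventually.of_forall fun n => hmono _) (Eventually.of_forall fun n => htend _)
    simpa only [lintegral_count] using this
  have hR : Tendsto (fun k => expNeg (ENNReal.ofReal ρ * ∫⁻ x, 1 - expNeg (g k x))) atTop
      (𝓝 (expNeg (ENNReal.ofReal ρ * ∫⁻ x, 1 - expNeg (f x)))) := by
    refine (continuous_expNeg.tendsto _).comp ?_
    refine ENNReal.Tendsto.const_mul ?_ (Or.inr ENNReal.ofReal_ne_top)
    refine lintegral_tendsto_of_tendsto_of_monotone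
      (fun k => (measurable_const.sub (measurable_expNeg.comp (g k).measurable)).aemeasurable)
      (Eventually.of_forall fun x j k hjk => tsub_le_tsub_left (expNeg_antitone (hmono x hjk)) _)
      (Eventually.of_forall fun x => ?_)
    exact ENNReal.Tendsto.sub tendsto_const_nhds ((continuous_expNeg.tendsto _).comp (htend x))
      (Or.inl ENNReal.one_ne_top)
  refine tendsto_nhds_unique hL (hR.congr fun k => (h.laplace_simpleFunc (g k) ?_ ?_).symm)
  · intro x
    rw [hg]
    refine ((Set.indicator_le_self' (fun _ _ => zero_le) x).trans_lt
      (SimpleFunc.eapprox_lt_top f k x)).ne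
  · intro c hc
    refine ((measure_mono ?_).trans_lt (measure_closedBall_lt_top (x := (0 : Plane)) (r := k))).ne
    intro x hx
    by_contra hx'
    rw [Set.mem_preimage, Set.mem_singleton_iff, hg, Set.indicator_of_notMem hx'] at hx
    exact hc hx.symm

end IsHomogeneousPPP

/-! ### Integrating out independent marks -/

lemma lintegral_comp_indepFun {Ω A B : Type*} [MeasurableSpace Ω] [MeasurableSpace A]
    [MeasurableSpace B] {P : Measure Ω} [IsProbabilityMeasure P] {Z : Ω → A} {U : Ω → B}
    (hZ : Measurable Z) (hU : Measurable U) (h : IndepFun Z U P) {F : A × B → ℝ≥0∞}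
    (hF : Measurable F) :
    ∫⁻ w, F (Z w, U w) ∂P = ∫⁻ w, ∫⁻ w', F (Z w, U w') ∂P ∂P := by
  have : IsProbabilityMeasure (P.map U) := Measure.isProbabilityMeasure_map hU.aemeasurable
  rw [← lintegral_map hF (hZ.prodMk hU),
    (indepFun_iff_map_prod_eq_prod_map_map hZ.aemeasurable hU.aemeasurable).1 h,
    lintegral_prod _ hF.aemeasurable, lintegral_map hF.lintegral_prod_right' hZ]
  refine lintegral_congr fun w => ?_
  exact lintegral_map (hF.comp measurable_prodMk_left) hU

/-- Given `Z`, the marks `U i` are still independent with unchanged laws, so each factor may be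
averaged separately. -/
lemma lintegral_prod_comp_indepFun {Ω A B ι : Type*} [Fintype ι] [MeasurableSpace Ω]
    [MeasurableSpace A] [MeasurableSpace B] {P : Measure Ω} [IsProbabilityMeasure P] {Z : Ω → A}
    {U : ι → Ω → B} (hZ : Measurable Z) (hU : ∀ i, Measurable (U i))
    (hZU : IndepFun Z (fun w i => U i w) P) (hUU : iIndepFun U P)
    {F : ι → A → B → ℝ≥0∞} (hF : ∀ i, Measurable (Function.uncurry (F i))) :
    ∫⁻ w, ∏ i, F i (Z w) (U i w) ∂P = ∫⁻ w, ∏ i, ∫⁻ b, F i (Z w) b ∂(P.map (U i)) ∂P := by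
  have hF' : Measurable fun q : A × (ι → B) => ∏ i, F i q.1 (q.2 i) :=
    Finset.measurable_prod _ fun i _ =>
      (hF i).comp (measurable_fst.prodMk ((measurable_pi_apply i).comp measurable_snd))
  rw [lintegral_comp_indepFun hZ (measurable_pi_lambda _ hU) hZU hF']
  refine lintegral_congr fun w => ?_
  have hFi : ∀ i, Measurable (F i (Z w)) := fun i => (hF i).comp measurable_prodMk_left
  simp only
  rw [lintegral_prod_eq_prod_lintegral_of_indepFun Finset.univ (fun i w' => F i (Z w) (U i w'))
    (hUU.comp (fun i => F i (Z w)) hFi) (fun i => (hFi i).comp (hU i))]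
  exact Finset.prod_congr rfl fun i _ => (lintegral_map (hFi i) (hU i)).symm

/-! ### Exponential and Bernoulli marks -/

lemma lintegral_expMeasure_one {f : ℝ → ℝ≥0∞} (hf : Measurable f) :
    ∫⁻ h, f h ∂(expMeasure 1) = ∫⁻ h in Set.Ioi 0, ENNReal.ofReal (Real.exp (-h)) * f h := by
  have hd : expMeasure 1 = volume.withDensity (exponentialPDF 1) := rfl
  have hm : Measurable (exponentialPDF 1) := (measurable_exponentialPDFReal 1).ennreal_ofReal
  rw [hd, lintegral_withDensity_eq_lintegral_mul _ hm hf,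
    ← setLIntegral_congr Ioi_ae_eq_Ici.symm, ← lintegral_indicator measurableSet_Ici]
  refine lintegral_congr fun h => ?_
  rcases lt_or_ge h 0 with hh | hh
  · simp [exponentialPDF_of_neg hh, hh]
  · simp [exponentialPDF_of_nonneg hh, hh]

lemma lintegral_exp_neg_mul_Ioi {a : ℝ} (ha : 0 < a) :
    ∫⁻ h in Set.Ioi (0 : ℝ), ENNReal.ofReal (Real.exp (-(a * h))) = ENNReal.ofReal (1 / a) := by
  have hi : IntegrableOn (fun h : ℝ => Real.exp (-(a * h))) (Set.Ioi 0) := by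
    simpa only [neg_mul] using exp_neg_integrableOn_Ioi 0 ha
  rw [← ofReal_integral_eq_lintegral_ofReal hi (Eventually.of_forall fun _ => (Real.exp_pos _).le)]
  have := integral_exp_mul_Ioi (neg_lt_zero.2 ha) 0
  simp only [neg_mul] at this
  rw [this]
  simp

lemma lintegral_expNeg_expMeasure {w : ℝ} (hw : 0 ≤ w) :
    ∫⁻ h, expNeg (ENNReal.ofReal (w * h)) ∂(expMeasure 1) = ENNReal.ofReal (1 / (1 + w)) := by
  rw [lintegral_expMeasure_one (by fun_prop), ← lintegral_exp_neg_mul_Ioi (by linarith : 0 < 1 + w)]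
  refine setLIntegral_congr_fun measurableSet_Ioi fun h hh => ?_
  have hh' : (0 : ℝ) < h := hh
  rw [expNeg_ofReal (by positivity), ← ENNReal.ofReal_mul (Real.exp_pos _).le, ← Real.exp_add]
  ring_nf

lemma lintegral_bool (Q : Measure Bool) (f : Bool → ℝ≥0∞) :
    ∫⁻ b, f b ∂Q = f true * Q {true} + f false * Q {false} := by
  rw [lintegral_fintype]; simp

/-- `-log (1 - p w / (1 + w))`, the cost of one node after averaging over its marks. -/
def markCost (p w : ℝ) : ℝ≥0∞ := ENNReal.ofReal (-Real.log (1 - p * (w / (1 + w))))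

/-- The strict bound keeps the logarithm in `markCost` finite even for `p = 1`. -/
lemma markCost_aux {p w : ℝ} (hp : 0 ≤ p) (hp' : p ≤ 1) (hw : 0 ≤ w) :
    0 ≤ p * (w / (1 + w)) ∧ p * (w / (1 + w)) < 1 := by
  have h1 : w / (1 + w) < 1 := by rw [div_lt_one (by linarith)]; linarith
  have h0 : 0 ≤ w / (1 + w) := by positivity
  exact ⟨by positivity, by nlinarith⟩

lemma expNeg_markCost {p w : ℝ} (hp : 0 ≤ p) (hp' : p ≤ 1) (hw : 0 ≤ w) :
    expNeg (markCost p w) = ENNReal.ofReal (1 - p * (w / (1 + w))) := by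
  obtain ⟨h0, h1⟩ := markCost_aux hp hp' hw
  rw [markCost, expNeg_ofReal, neg_neg, Real.exp_log (by linarith)]
  have := Real.log_nonpos (by linarith : (0 : ℝ) ≤ 1 - p * (w / (1 + w))) (by linarith)
  linarith

/-- Although the cost of a node is a logarithm, its Poisson Laplace exponent is linear in `p`:
independent thinning only rescales the density. -/
lemma one_sub_expNeg_markCost {p w : ℝ} (hp : 0 ≤ p) (hp' : p ≤ 1) (hw : 0 ≤ w) :
    1 - expNeg (markCost p w) = ENNReal.ofReal p * ENNReal.ofReal (w / (1 + w)) := by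
  obtain ⟨h0, h1⟩ := markCost_aux hp hp' hw
  rw [expNeg_markCost hp hp' hw, ← ENNReal.ofReal_one, ← ENNReal.ofReal_sub _ (by linarith),
    ← ENNReal.ofReal_mul hp]
  ring_nf

@[fun_prop] lemma measurable_markCost (p : ℝ) : Measurable (markCost p) := by
  unfold markCost; fun_prop

namespace NetworkParams

variable {K M : ℕ} {prm : NetworkParams K M}

lemma Admissible.allPTr_nonneg (h : prm.Admissible) (m : Fin (M + 1)) : 0 ≤ prm.allPTr m := by
  refine Fin.cases ?_ (fun m => ?_) m
  · exact h.pTr_pos.le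
  · exact h.tierPTr_nonneg m

lemma Admissible.allPTr_le (h : prm.Admissible) (m : Fin (M + 1)) : prm.allPTr m ≤ 1 := by
  refine Fin.cases ?_ (fun m => ?_) m
  · exact h.pTr_le
  · exact h.tierPTr_le m

end NetworkParams

namespace Network

variable {Ω : Type*} {K M : ℕ} {N : Network Ω K M}

/-- The σ-algebra on `Ω` is arbitrary because the lemma is later applied to the one generated by the
locations of a single tier. -/
lemma measurable_expNeg_tsum_comp [MeasurableSpace Ω] {X : ℕ → Ω → Plane}
    (hX : ∀ n, Measurable (X n)) {f : Plane → ℝ≥0∞} (hf : Measurable f) :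
    Measurable fun w => expNeg (∑' n, f (X n w)) :=
  measurable_expNeg.comp (Measurable.tsum fun n => hf.comp (hX n))

/-! ### Groups of independent sources -/

/-- The σ-algebra generated by a set of sources of randomness. -/
@[reducible] def sigmaOf (N : Network Ω K M) (S : Set (Source K M)) : MeasurableSpace Ω :=
  ⨆ s ∈ S, N.sourceSigma s

lemma sourceSigma_le_sigmaOf {S : Set (Source K M)} {s : Source K M} (hs : s ∈ S) :
    N.sourceSigma s ≤ N.sigmaOf S := le_iSup₂_of_le s hs le_rfl

lemma measurable_clusterOn_sigmaOf {S : Set (Source K M)} {i : Fin K} (h : .clusterOn i ∈ S) :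
    Measurable[N.sigmaOf S] (N.clusterOn i) :=
  (comap_measurable _).mono (sourceSigma_le_sigmaOf (N := N) h) le_rfl

lemma measurable_clusterFading_sigmaOf {S : Set (Source K M)} {i : Fin K}
    (h : .clusterFading i ∈ S) : Measurable[N.sigmaOf S] (N.clusterFading i) :=
  (comap_measurable _).mono (sourceSigma_le_sigmaOf (N := N) h) le_rfl

lemma measurable_on_sigmaOf {S : Set (Source K M)} {m : Fin (M + 1)} {n : ℕ} (h : .on m n ∈ S) :
    Measurable[N.sigmaOf S] (N.on m n) :=
  (comap_measurable _).mono (sourceSigma_le_sigmaOf (N := N) h) le_rfl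

lemma measurable_fading_sigmaOf {S : Set (Source K M)} {m : Fin (M + 1)} {n : ℕ}
    (h : .fading m n ∈ S) : Measurable[N.sigmaOf S] (N.fading m n) :=
  (comap_measurable _).mono (sourceSigma_le_sigmaOf (N := N) h) le_rfl

lemma measurable_points_sourceSigma (m : Fin (M + 1)) (n : ℕ) :
    Measurable[N.sourceSigma (.points m)] (N.points m n) :=
  (comap_measurable _).mono
    (le_iSup (fun n => MeasurableSpace.comap (N.points m n) inferInstance) n) le_rfl

lemma measurable_points_sigmaOf {S : Set (Source K M)} {m : Fin (M + 1)} {n : ℕ}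
    (h : .points m ∈ S) : Measurable[N.sigmaOf S] (N.points m n) :=
  (measurable_points_sourceSigma m n).mono (sourceSigma_le_sigmaOf (N := N) h) le_rfl

/-! ### Laplace transform of the total interference -/

/-- Total interference when a node of tier `m` at `x` contributes with weight `W m x`. -/
def interference (N : Network Ω K M) (W : Fin (M + 1) → Plane → ℝ) (w : Ω) : ℝ≥0∞ :=
  ∑ m, ∑' n, if N.on m n w = true then
    ENNReal.ofReal (W m (N.points m n w) * N.fading m n w) else 0

lemma measurable_interference [MeasurableSpace Ω] (hX : ∀ m n, Measurable (N.points m n))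
    (hon : ∀ m n, Measurable (N.on m n)) (hH : ∀ m n, Measurable (N.fading m n))
    {W : Fin (M + 1) → Plane → ℝ} (hW : ∀ m, Measurable (W m)) :
    Measurable (N.interference W) := by
  refine Finset.measurable_sum _ fun m _ => Measurable.tsum fun n => ?_
  exact Measurable.ite (hon m n (measurableSet_singleton true))
    (((hW m).comp (hX m n)).mul (hH m n)).ennreal_ofReal measurable_const

namespace IsModel

variable [MeasurableSpace Ω] {P : Measure Ω} {prm : NetworkParams K M}

lemma sourceSigma_le (hN : N.IsModel P prm) (s : Source K M) :
    N.sourceSigma s ≤ ‹MeasurableSpace Ω› := by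
  cases s with
  | clusterOn i => exact (hN.measurable_clusterOn i).comap_le
  | clusterFading i => exact (hN.measurable_clusterFading i).comap_le
  | points m => exact iSup_le fun n => ((hN.points_law m).measurable n).comap_le
  | on m n => exact (hN.measurable_on m n).comap_le
  | fading m n => exact (hN.measurable_fading m n).comap_le

/-- Disjoint families of independent sources generate independent σ-algebras. Every independence
claim between composite quantities below reduces to naming the sources that each one uses. -/
lemma indepFun (hN : N.IsModel P prm) {A B : Type*} [MeasurableSpace A] [MeasurableSpace B]
    {f : Ω → A} {g : Ω → B} {S T : Set (Source K M)} (hST : Disjoint S T)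
    (hf : Measurable[N.sigmaOf S] f) (hg : Measurable[N.sigmaOf T] g) : IndepFun f g P :=
  (IndepFun_iff_Indep _ _ _).2 <| indep_of_indep_of_le_left
    (indep_of_indep_of_le_right (indep_iSup_of_disjoint hN.sourceSigma_le hN.indep hST)
      hg.comap_le) hf.comap_le

lemma map_on [IsProbabilityMeasure P] (hN : N.IsModel P prm) (hprm : prm.Admissible)
    (m : Fin (M + 1)) (n : ℕ) (f : Bool → ℝ≥0∞) :
    ∫⁻ b, f b ∂(P.map (N.on m n))
      = f true * ENNReal.ofReal (prm.allPTr m) + f false * ENNReal.ofReal (1 - prm.allPTr m) := by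
  have ht : P.map (N.on m n) {true} = ENNReal.ofReal (prm.allPTr m) := by
    rw [Measure.map_apply (hN.measurable_on m n) (measurableSet_singleton _)]
    exact hN.on_law m n
  have : IsProbabilityMeasure (P.map (N.on m n)) :=
    Measure.isProbabilityMeasure_map (hN.measurable_on m n).aemeasurable
  have hf : P.map (N.on m n) {false} = ENNReal.ofReal (1 - prm.allPTr m) := by
    have : ({false} : Set Bool) = {true}ᶜ := by ext b; cases b <;> simp
    rw [this, prob_compl_eq_one_sub (measurableSet_singleton _), ht,
      ENNReal.ofReal_sub _ (hprm.allPTr_nonneg m), ENNReal.ofReal_one]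
  rw [lintegral_bool, ht, hf]

/-- Fading and transmission indicators are integrated out one after the other. -/
lemma lintegral_finite_marks [IsProbabilityMeasure P] (hN : N.IsModel P prm)
    (hprm : prm.Admissible) {W : Fin (M + 1) → Plane → ℝ} (hW : ∀ m, Measurable (W m))
    (hW0 : ∀ m x, 0 ≤ W m x) (L : ℕ) :
    ∫⁻ w, ∏ i : Fin (M + 1) × Fin L, expNeg (if N.on i.1 i.2 w = true then
        ENNReal.ofReal (W i.1 (N.points i.1 i.2 w) * N.fading i.1 i.2 w) else 0) ∂P
      = ∫⁻ w, ∏ i : Fin (M + 1) × Fin L,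
        expNeg (markCost (prm.allPTr i.1) (W i.1 (N.points i.1 i.2 w))) ∂P := by
  have hX : ∀ m n, Measurable (N.points m n) := fun m => (hN.points_law m).measurable
  have hinjF : Function.Injective
      (fun i : Fin (M + 1) × Fin L => (Source.fading i.1 i.2 : Source K M)) := by
    rintro ⟨a, b⟩ ⟨c, d⟩ h
    simp only [Source.fading.injEq] at h
    exact Prod.ext h.1 (Fin.ext h.2)
  have hinjO : Function.Injective
      (fun i : Fin (M + 1) × Fin L => (Source.on i.1 i.2 : Source K M)) := by
    rintro ⟨a, b⟩ ⟨c, d⟩ h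
    simp only [Source.on.injEq] at h
    exact Prod.ext h.1 (Fin.ext h.2)
  have hindF : iIndepFun (fun i : Fin (M + 1) × Fin L => N.fading i.1 i.2) P :=
    hN.indep.precomp hinjF
  have hindO : iIndepFun (fun i : Fin (M + 1) × Fin L => N.on i.1 i.2) P :=
    hN.indep.precomp hinjO
  set SP : Set (Source K M) := Set.range Source.points
  set SO : Set (Source K M) := Set.range fun q : Fin (M + 1) × ℕ => Source.on q.1 q.2
  set SF : Set (Source K M) := Set.range fun q : Fin (M + 1) × ℕ => Source.fading q.1 q.2
  have hdisjF : Disjoint (SP ∪ SO) SF := by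
    rw [Set.disjoint_left]
    rintro s (⟨m, rfl⟩ | ⟨q, rfl⟩) ⟨q', h⟩ <;> simp at h
  have hdisjO : Disjoint SP SO := by
    rw [Set.disjoint_left]
    rintro s ⟨m, rfl⟩ ⟨q', h⟩
    simp at h
  -- the fading powers
  let Z : Ω → (Fin (M + 1) × Fin L → Plane) × (Fin (M + 1) × Fin L → Bool) :=
    fun w => (fun i => N.points i.1 i.2 w, fun i => N.on i.1 i.2 w)
  have hZP : Measurable[N.sigmaOf (SP ∪ SO)]
      fun w (i : Fin (M + 1) × Fin L) => N.points i.1 i.2 w :=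
    @measurable_pi_lambda _ _ _ (N.sigmaOf (SP ∪ SO)) _ _ fun i =>
      measurable_points_sigmaOf (Or.inl ⟨i.1, rfl⟩)
  have hZO : Measurable[N.sigmaOf (SP ∪ SO)]
      fun w (i : Fin (M + 1) × Fin L) => N.on i.1 i.2 w :=
    @measurable_pi_lambda _ _ _ (N.sigmaOf (SP ∪ SO)) _ _ fun i =>
      measurable_on_sigmaOf (Or.inr ⟨(i.1, i.2), rfl⟩)
  have hZ' : Measurable[N.sigmaOf (SP ∪ SO)] Z :=
    hZP.prodMk hZO
  have hZ : Measurable Z :=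
    (measurable_pi_lambda _ fun i : Fin (M + 1) × Fin L => hX i.1 i.2).prodMk
      (measurable_pi_lambda _ fun i : Fin (M + 1) × Fin L => hN.measurable_on i.1 i.2)
  have hZU : IndepFun Z (fun w (i : Fin (M + 1) × Fin L) => N.fading i.1 i.2 w) P :=
    hN.indepFun hdisjF hZ' (@measurable_pi_lambda _ _ _ (N.sigmaOf SF) _ _ fun i : Fin (M + 1) × Fin L =>
      measurable_fading_sigmaOf ⟨(i.1, i.2), rfl⟩)
  have step1 := lintegral_prod_comp_indepFun hZ
    (fun i : Fin (M + 1) × Fin L => hN.measurable_fading i.1 i.2) hZU hindF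
    (F := fun i z h => expNeg (if z.2 i = true then ENNReal.ofReal (W i.1 (z.1 i) * h) else 0))
    (fun i => by
      refine measurable_expNeg.comp (Measurable.ite ?_ ?_ measurable_const)
      · have hb : Measurable fun q : ((Fin (M + 1) × Fin L → Plane) ×
            (Fin (M + 1) × Fin L → Bool)) × ℝ => q.1.2 i :=
          (measurable_pi_apply i).comp (measurable_snd.comp measurable_fst)
        exact hb (measurableSet_singleton true)
      · exact (((hW i.1).comp ((measurable_pi_apply i).comp
          (measurable_fst.comp measurable_fst))).mul measurable_snd).ennreal_ofReal)
  -- the transmission indicators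
  let Z₂ : Ω → Fin (M + 1) × Fin L → Plane := fun w i => N.points i.1 i.2 w
  have hZ₂' : Measurable[N.sigmaOf SP] Z₂ :=
    @measurable_pi_lambda _ _ _ (N.sigmaOf SP) _ _ fun i =>
      measurable_points_sigmaOf ⟨i.1, rfl⟩
  have hZ₂U : IndepFun Z₂ (fun w (i : Fin (M + 1) × Fin L) => N.on i.1 i.2 w) P :=
    hN.indepFun hdisjO hZ₂' (@measurable_pi_lambda _ _ _ (N.sigmaOf SO) _ _ fun i : Fin (M + 1) × Fin L =>
      measurable_on_sigmaOf ⟨(i.1, i.2), rfl⟩)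
  have step2 := lintegral_prod_comp_indepFun (measurable_pi_lambda _ fun i : Fin (M + 1) × Fin L => hX i.1 i.2)
    (fun i : Fin (M + 1) × Fin L => hN.measurable_on i.1 i.2) hZ₂U hindO
    (F := fun i z b => if b = true then ENNReal.ofReal (1 / (1 + W i.1 (z i))) else 1)
    (fun i => by
      refine Measurable.ite ?_ ?_ measurable_const
      · exact measurable_snd (measurableSet_singleton true)
      · exact (measurable_const.div (measurable_const.add ((hW i.1).comp
          ((measurable_pi_apply i).comp measurable_fst)))).ennreal_ofReal)
  refine step1.trans (Eq.trans ?_ (step2.trans ?_))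
  · refine lintegral_congr fun w => Finset.prod_congr rfl fun i _ => ?_
    rw [hN.fading_law]
    have : IsProbabilityMeasure (expMeasure 1) := isProbabilityMeasure_expMeasure one_pos
    by_cases hb : N.on i.1 i.2 w = true
    · simp only [Z, hb, if_true]
      exact lintegral_expNeg_expMeasure (hW0 _ _)
    · simp [Z, hb]
  · refine lintegral_congr fun w => Finset.prod_congr rfl fun i _ => ?_
    rw [hN.map_on hprm]
    have hp := hprm.allPTr_nonneg i.1
    have hp' := hprm.allPTr_le i.1
    have hw := hW0 i.1 (N.points i.1 i.2 w)
    simp only [if_true, one_mul, Bool.false_eq_true, if_false]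
    -- An active node contributes `1 / (1 + w)` and a silent one 1, so the average is `p / (1 + w) +
    -- (1 - p) = 1 - p w / (1 + w)`.
    rw [expNeg_markCost hp hp' hw, ← ENNReal.ofReal_mul (by positivity),
      ← ENNReal.ofReal_add (by positivity) (by linarith)]
    congr 1
    field_simp
    ring

/-- The Laplace transform of the total interference. -/
theorem laplace_interference [IsProbabilityMeasure P] (hN : N.IsModel P prm)
    (hprm : prm.Admissible) {W : Fin (M + 1) → Plane → ℝ} (hW : ∀ m, Measurable (W m))
    (hW0 : ∀ m x, 0 ≤ W m x) :
    ∫⁻ w, expNeg (N.interference W w) ∂P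
      = expNeg (∑ m, ENNReal.ofReal (prm.allDens m) *
          (ENNReal.ofReal (prm.allPTr m) * ∫⁻ x, ENNReal.ofReal (W m x / (1 + W m x)))) := by
  have hX : ∀ m n, Measurable (N.points m n) := fun m => (hN.points_law m).measurable
  have hmk : ∀ m, Measurable fun x => markCost (prm.allPTr m) (W m x) :=
    fun m => (measurable_markCost _).comp (hW m)
  have hprod : ∀ (L : ℕ) (y : Fin (M + 1) → ℕ → ℝ≥0∞),
      expNeg (∑ m, ∑ n ∈ Finset.range L, y m n)
        = ∏ i : Fin (M + 1) × Fin L, expNeg (y i.1 i.2) := by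
    intro L y
    rw [← expNeg_sum, Fintype.sum_prod_type]
    simp_rw [Finset.sum_range]
  have htend : ∀ y : Fin (M + 1) → ℕ → ℝ≥0∞,
      Tendsto (fun L => ∑ m, ∑ n ∈ Finset.range L, y m n) atTop (𝓝 (∑ m, ∑' n, y m n)) :=
    fun y => tendsto_finsetSum _ fun m _ => ENNReal.tendsto_nat_tsum _
  have h1 := tendsto_lintegral_expNeg (P := P)
    (F := fun L w => ∑ m, ∑ n ∈ Finset.range L, if N.on m n w = true then
      ENNReal.ofReal (W m (N.points m n w) * N.fading m n w) else 0)
    (f := N.interference W)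
    (fun L => Finset.measurable_sum _ fun m _ => Finset.measurable_sum _ fun n _ =>
      Measurable.ite (hN.measurable_on m n (measurableSet_singleton true))
        (((hW m).comp (hX m n)).mul (hN.measurable_fading m n)).ennreal_ofReal measurable_const)
    (fun w => htend _)
  have h2 := tendsto_lintegral_expNeg (P := P)
    (F := fun L w => ∑ m, ∑ n ∈ Finset.range L, markCost (prm.allPTr m) (W m (N.points m n w)))
    (f := fun w => ∑ m, ∑' n, markCost (prm.allPTr m) (W m (N.points m n w)))
    (fun L => Finset.measurable_sum _ fun m _ => Finset.measurable_sum _ fun n _ =>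
      (hmk m).comp (hX m n))
    (fun w => htend _)
  -- For each `L` the first `L` nodes of every tier give equal expectations with marks and with
  -- averaged marks, so the two limits agree.
  have h3 := tendsto_nhds_unique h1 (h2.congr fun L => by
    simp_rw [hprod]
    exact (hN.lintegral_finite_marks hprm hW hW0 L).symm)
  rw [h3]
  simp_rw [expNeg_sum]
  have hinj : Function.Injective (Source.points : Fin (M + 1) → Source K M) :=
    fun a b h => by simpa using h
  have hmeas : ∀ m, Measurable[N.sourceSigma (.points m)]
      fun w => expNeg (∑' n, markCost (prm.allPTr m) (W m (N.points m n w))) := fun m =>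
    @measurable_expNeg_tsum_comp _ (N.sourceSigma (.points m)) _
      (fun n => measurable_points_sourceSigma m n) _ (hmk m)
  have hind : iIndepFun
      (fun m w => expNeg (∑' n, markCost (prm.allPTr m) (W m (N.points m n w)))) P :=
    iIndep_of_iIndep_of_le (hN.indep.precomp hinj) fun m => (hmeas m).comap_le
  rw [lintegral_prod_eq_prod_lintegral_of_indepFun Finset.univ _ hind
    (fun m => (hmeas m).mono (hN.sourceSigma_le _) le_rfl)]
  refine Finset.prod_congr rfl fun m _ => ?_
  rw [(hN.points_law m).laplace (hmk m)]
  simp_rw [one_sub_expNeg_markCost (hprm.allPTr_nonneg m) (hprm.allPTr_le m) (hW0 m _)]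
  rw [lintegral_const_mul' _ _ ENNReal.ofReal_ne_top]

end IsModel

end Network

/-! ### Hypoexponential tails -/

/-- Coefficient of `exp (-a j x)` in the tail of `∑ l ∈ s, B l * E l`, with `B l` Bernoulli of
parameter `p` and `E l` exponential of rate `a l`, all independent. -/
def tailCoeff {ι : Type*} [DecidableEq ι] (p : ℝ) (a : ι → ℝ) (s : Finset ι) (j : ι) : ℝ :=
  p * ∏ l ∈ s.erase j, (a l - (1 - p) * a j) / (a l - a j)

section tailCoeff

variable {ι : Type*} [DecidableEq ι] {p : ℝ} {a : ι → ℝ} {s : Finset ι}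

lemma tailCoeff_insert_of_mem {i j : ι} (hi : i ∉ s) (hj : j ∈ s) :
    tailCoeff p a (insert i s) j
      = tailCoeff p a s j * ((a i - (1 - p) * a j) / (a i - a j)) := by
  have hij : i ≠ j := fun h => hi (h ▸ hj)
  rw [tailCoeff, tailCoeff, Finset.erase_insert_of_ne hij,
    Finset.prod_insert (fun h => hi (Finset.mem_of_mem_erase h))]
  ring

/-- Partial fraction expansion of `∏ j ∈ s, (a j - (1 - p) x) / (a j - x)`. -/
lemma prod_eq_one_sub_sum_tailCoeff (ha : Set.InjOn a s) {x : ℝ} (hx : ∀ j ∈ s, a j ≠ x) :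
    ∏ j ∈ s, (a j - (1 - p) * x) / (a j - x)
      = 1 - ∑ j ∈ s, tailCoeff p a s j * (x / (x - a j)) := by
  -- The induction hypothesis is needed both at `x` and at the new rate `a i`.
  induction s using Finset.induction_on generalizing x with
  | empty => simp
  | insert i s hi ih =>
    have ha' : Set.InjOn a s := ha.mono (by simp)
    have hai : ∀ j ∈ s, a j ≠ a i := fun j hj h =>
      hi (ha (by simp) (by simp [hj]) h.symm ▸ hj)
    rw [Finset.prod_insert hi, Finset.sum_insert hi,
      ih ha' fun j hj => hx j (Finset.mem_insert_of_mem hj)]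
    have h1 : tailCoeff p a (insert i s) i
        = p * (1 - ∑ j ∈ s, tailCoeff p a s j * (a i / (a i - a j))) := by
      rw [tailCoeff, Finset.erase_insert hi, ih ha' hai]
    have hxi : a i - x ≠ 0 := sub_ne_zero.2 (hx i (by simp))
    have hxi' : x - a i ≠ 0 := sub_ne_zero.2 (hx i (by simp)).symm
    have hterm : ∀ j ∈ s, tailCoeff p a (insert i s) j * (x / (x - a j))
        = (a i - (1 - p) * x) / (a i - x) * (tailCoeff p a s j * (x / (x - a j)))
          + p * (x / (x - a i)) * (tailCoeff p a s j * (a i / (a i - a j))) := by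
      intro j hj
      have e1 : a i - a j ≠ 0 := sub_ne_zero.2 (hai j hj).symm
      have e2 : x - a j ≠ 0 := sub_ne_zero.2 (hx j (Finset.mem_insert_of_mem hj)).symm
      have e3 : (a i - x) = -(x - a i) := by ring
      rw [tailCoeff_insert_of_mem hi hj, e3]
      field_simp
      ring
    rw [h1, Finset.sum_congr rfl hterm, Finset.sum_add_distrib, ← Finset.mul_sum, ← Finset.mul_sum]
    have e3 : (a i - x) = -(x - a i) := by ring
    rw [e3]
    field_simp
    ring

/-- The product defining the new coefficient is the partial fraction identity evaluated at `x = a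
i`. The bracket is exactly the weight that `prob_lt_exp_add` attaches to the rate of the added
exponential. -/
lemma tailCoeff_insert_self {i : ι} (hi : i ∉ s) (ha : Set.InjOn a (insert i s : Finset ι)) :
    tailCoeff p a (insert i s) i
      = p * (1 - ∑ j ∈ s, tailCoeff p a s j * (a i / (a i - a j))) := by
  rw [tailCoeff, Finset.erase_insert hi, prod_eq_one_sub_sum_tailCoeff (ha.mono (by simp))]
  exact fun j hj h => hi (ha (by simp) (by simp [hj]) h.symm ▸ hj)

end tailCoeff

lemma integral_exp_sub_interval {a b x : ℝ} (ha : 0 < a) (hab : a ≠ b) :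
    ∫ h in (0 : ℝ)..(x * a), Real.exp (-h) * Real.exp (-(b * (x - h / a)))
      = a / (a - b) * (Real.exp (-(b * x)) - Real.exp (-(a * x))) := by
  have hab' : a - b ≠ 0 := sub_ne_zero.2 hab
  have hd : ∀ h ∈ Set.uIcc 0 (x * a), HasDerivAt
      (fun h => -(a / (a - b)) * Real.exp (-(b * x) + (b / a - 1) * h))
      (Real.exp (-h) * Real.exp (-(b * (x - h / a)))) h := by
    intro h _
    refine (((((hasDerivAt_id h).const_mul (b / a - 1)).const_add (-(b * x))).exp).const_mul
      (-(a / (a - b)))).congr_deriv ?_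
    rw [← Real.exp_add]
    have : -h + -(b * (x - h / a)) = -(b * x) + (b / a - 1) * h := by field_simp; ring
    rw [this]
    simp only [id]
    field_simp
    ring
  rw [intervalIntegral.integral_eq_sub_of_hasDerivAt hd
    (by apply Continuous.intervalIntegrable; fun_prop)]
  have : -(b * x) + (b / a - 1) * (x * a) = -(a * x) := by field_simp; ring
  rw [this]
  simp only [mul_zero, add_zero]
  ring

/-- Adding an independent exponential variable of rate `a` to a variable whose tail is a mixture of
exponentials. -/
lemma prob_lt_exp_add {Ω ι : Type*} [MeasurableSpace Ω] {P : Measure Ω} [IsProbabilityMeasure P]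
    {H : Ω → ℝ} {S : Ω → ℝ≥0∞} (hH : Measurable H) (hS : Measurable S) (hHS : IndepFun H S P)
    (hlaw : P.map H = expMeasure 1) {s : Finset ι} {c b : ι → ℝ}
    (htail : ∀ x : ℝ, 0 ≤ x →
      P.real {w | ENNReal.ofReal x < S w} = ∑ j ∈ s, c j * Real.exp (-(b j * x)))
    {a : ℝ} (ha : 0 < a) (hab : ∀ j ∈ s, a ≠ b j) {x : ℝ} (hx : 0 ≤ x) :
    P.real {w | ENNReal.ofReal x < ENNReal.ofReal (a⁻¹ * H w) + S w}
      = (1 - ∑ j ∈ s, c j * (a / (a - b j))) * Real.exp (-(a * x))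
        + ∑ j ∈ s, c j * (a / (a - b j)) * Real.exp (-(b j * x)) := by
  have hset : MeasurableSet {q : ℝ × ℝ≥0∞ | ENNReal.ofReal x < ENNReal.ofReal (a⁻¹ * q.1) + q.2} :=
    measurableSet_lt measurable_const (by fun_prop)
  set F : ℝ × ℝ≥0∞ → ℝ≥0∞ :=
    Set.indicator {q | ENNReal.ofReal x < ENNReal.ofReal (a⁻¹ * q.1) + q.2} 1
  have hF : Measurable F := measurable_one.indicator hset
  have h1 : P {w | ENNReal.ofReal x < ENNReal.ofReal (a⁻¹ * H w) + S w}
      = ∫⁻ w, F (H w, S w) ∂P := by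
    rw [← lintegral_indicator_one (measurableSet_lt measurable_const (by fun_prop))]
    rfl
  set G : ℝ → ℝ := fun h => P.real {w | ENNReal.ofReal x < ENNReal.ofReal (a⁻¹ * h) + S w}
  have h2 : ∀ h : ℝ, ∫⁻ w', F (h, S w') ∂P = ENNReal.ofReal (G h) := by
    intro h
    simp only [G, Measure.real]
    rw [ENNReal.ofReal_toReal (measure_ne_top _ _),
      ← lintegral_indicator_one (measurableSet_lt measurable_const (by fun_prop))]
    rfl
  have hGm : Measurable G := by
    have : Measurable fun h : ℝ => ∫⁻ w', F (h, S w') ∂P := by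
      apply Measurable.lintegral_prod_right'
        (f := fun q : ℝ × Ω => F (q.1, S q.2))
      exact hF.comp (measurable_fst.prodMk (hS.comp measurable_snd))
    convert this.ennreal_toReal using 2 with h
    rw [h2, ENNReal.toReal_ofReal measureReal_nonneg]
  have hxa : 0 ≤ x * a := by positivity
  -- Conditionally on `H = h`, as long as `h / a ≤ x` the remaining sum must exceed `x - h / a`; its
  -- known tail applies there.
  have hGle : ∀ h ∈ Set.Ioc 0 (x * a),
      G h = ∑ j ∈ s, c j * Real.exp (-(b j * (x - h / a))) := by
    intro h hh
    have e : h / a ≤ x := by rw [div_le_iff₀ ha]; exact hh.2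
    have e0 : 0 ≤ h / a := div_nonneg hh.1.le ha.le
    rw [← htail _ (sub_nonneg.2 e)]
    simp only [G]
    congr 1
    ext w
    simp only [Set.mem_ofPred_eq]
    rw [ENNReal.ofReal_sub _ e0, inv_mul_eq_div, ENNReal.sub_lt_iff_lt_left ENNReal.ofReal_ne_top
      (ENNReal.ofReal_le_ofReal e)]
  -- Beyond `h = x a` the exponential term alone exceeds the level.
  have hGgt : ∀ h ∈ Set.Ioi (x * a), G h = 1 := by
    intro h hh
    have e : x < a⁻¹ * h := by rw [inv_mul_eq_div, lt_div_iff₀ ha]; exact hh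
    have : {w | ENNReal.ofReal x < ENNReal.ofReal (a⁻¹ * h) + S w} = Set.univ := by
      ext w
      simp only [Set.mem_ofPred_eq, Set.mem_univ, iff_true]
      exact lt_of_lt_of_le ((ENNReal.ofReal_lt_ofReal_iff (by linarith)).2 e) le_self_add
    simp only [G, this, probReal_univ]
  have h3 : P.real {w | ENNReal.ofReal x < ENNReal.ofReal (a⁻¹ * H w) + S w}
      = ∫ h in Set.Ioi 0, Real.exp (-h) * G h := by
    rw [Measure.real, h1, lintegral_comp_indepFun hH hS hHS hF]
    simp_rw [h2]
    rw [← lintegral_map (f := fun h => ENNReal.ofReal (G h)) hGm.ennreal_ofReal hH, hlaw,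
      lintegral_expMeasure_one hGm.ennreal_ofReal,
      integral_eq_lintegral_of_nonneg_ae]
    · congr 1
      refine lintegral_congr fun h => ?_
      rw [ENNReal.ofReal_mul (Real.exp_pos _).le]
    · exact Eventually.of_forall fun h => mul_nonneg (Real.exp_pos _).le measureReal_nonneg
    · exact ((Real.measurable_exp.comp measurable_neg).mul hGm).aestronglyMeasurable
  have hint : IntegrableOn (fun h => Real.exp (-h) * G h) (Set.Ioi 0) := by
    refine Integrable.mono' (g := fun h => Real.exp (-h)) ?_ ?_ ?_
    · have := exp_neg_integrableOn_Ioi 0 one_pos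
      simp only [neg_mul, one_mul] at this
      exact this
    · exact ((Real.measurable_exp.comp measurable_neg).mul hGm).aestronglyMeasurable
    · refine Eventually.of_forall fun h => ?_
      rw [norm_mul, Real.norm_eq_abs, Real.norm_eq_abs, abs_of_pos (Real.exp_pos _),
        abs_of_nonneg measureReal_nonneg]
      exact mul_le_of_le_one_right (Real.exp_pos _).le measureReal_le_one
  have hsplit : Set.Ioi (0 : ℝ) = Set.Ioc 0 (x * a) ∪ Set.Ioi (x * a) :=
    (Set.Ioc_union_Ioi_eq_Ioi hxa).symm
  rw [h3, hsplit, setIntegral_union (Set.Ioc_disjoint_Ioi le_rfl) measurableSet_Ioi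
    (hint.mono_set Set.Ioc_subset_Ioi_self) (hint.mono_set (Set.Ioi_subset_Ioi hxa)),
    setIntegral_congr_fun (g := fun h => Real.exp (-h)) measurableSet_Ioi
      (fun h hh => by simp only [hGgt h hh, mul_one]),
    integral_exp_neg_Ioi,
    setIntegral_congr_fun (g := fun h => ∑ j ∈ s, c j *
      (Real.exp (-h) * Real.exp (-(b j * (x - h / a))))) measurableSet_Ioc
      (fun h hh => by
        simp only [hGle h hh, Finset.mul_sum]
        exact Finset.sum_congr rfl fun j _ => by ring),
    ← intervalIntegral.integral_of_le hxa, intervalIntegral.integral_finsetSum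
      (fun j _ => by apply Continuous.intervalIntegrable; fun_prop)]
  rw [Finset.sum_congr rfl fun j hj => by
    rw [intervalIntegral.integral_const_mul, integral_exp_sub_interval ha (hab j hj)],
    show -(x * a) = -(a * x) by ring, sub_mul, Finset.sum_mul, one_mul]
  have : ∀ j ∈ s, c j * (a / (a - b j) * (Real.exp (-(b j * x)) - Real.exp (-(a * x))))
      = c j * (a / (a - b j)) * Real.exp (-(b j * x))
        - c j * (a / (a - b j)) * Real.exp (-(a * x)) := fun j _ => by ring
  rw [Finset.sum_congr rfl this, Finset.sum_sub_distrib]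
  ring

/-! ### Tail of the received signal power -/

namespace Network

variable {Ω : Type*} {K M : ℕ} {N : Network Ω K M}

/-- Signal power received from the serving transmitters in `s`. -/
def partialSignal (N : Network Ω K M) (η : ℝ) (d : Fin K → ℝ) (s : Finset (Fin K)) (w : Ω) :
    ℝ≥0∞ :=
  ∑ i ∈ s, if N.clusterOn i w = true then ENNReal.ofReal (d i ^ (-η) * N.clusterFading i w) else 0

lemma measurable_partialSignal [MeasurableSpace Ω] (η : ℝ) (d : Fin K → ℝ) {s : Finset (Fin K)}
    (hon : ∀ i ∈ s, Measurable (N.clusterOn i)) (hH : ∀ i ∈ s, Measurable (N.clusterFading i)) :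
    Measurable (N.partialSignal η d s) :=
  Finset.measurable_sum _ fun i hi => Measurable.ite (hon i hi (measurableSet_singleton true))
    (measurable_const.mul (hH i hi)).ennreal_ofReal measurable_const

/-- Sources of randomness of the serving transmitters in `s`. -/
def clusterSources (s : Set (Fin K)) : Set (Source K M) :=
  Source.clusterOn '' s ∪ Source.clusterFading '' s

lemma measurable_partialSignal_sigmaOf (η : ℝ) (d : Fin K → ℝ) (s : Finset (Fin K)) :
    Measurable[N.sigmaOf (clusterSources s)] (N.partialSignal η d s) :=
  @measurable_partialSignal _ _ _ N (N.sigmaOf (clusterSources s)) η d s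
    (fun i hi => measurable_clusterOn_sigmaOf (Or.inl ⟨i, hi, rfl⟩))
    (fun i hi => measurable_clusterFading_sigmaOf (Or.inr ⟨i, hi, rfl⟩))

namespace IsModel

variable [MeasurableSpace Ω] {P : Measure Ω} {prm : NetworkParams K M}

lemma measurable_partialSignal (hN : N.IsModel P prm) (η : ℝ) (d : Fin K → ℝ)
    (s : Finset (Fin K)) : Measurable (N.partialSignal η d s) :=
  Network.measurable_partialSignal η d (fun i _ => hN.measurable_clusterOn i)
    (fun i _ => hN.measurable_clusterFading i)

/-- The tail of the received signal power is a mixture of exponentials. -/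
theorem signal_tail [IsProbabilityMeasure P] (hN : N.IsModel P prm) (hprm : prm.Admissible)
    {η : ℝ} {d : Fin K → ℝ} (hd : ∀ i, 0 < d i) (hinj : Function.Injective fun i => d i ^ η)
    (s : Finset (Fin K)) {x : ℝ} (hx : 0 ≤ x) :
    P.real {w | ENNReal.ofReal x < N.partialSignal η d s w}
      = ∑ j ∈ s, tailCoeff prm.pTr (fun i => d i ^ η) s j * Real.exp (-(d j ^ η * x)) := by
  induction s using Finset.induction_on generalizing x with
  | empty => simp [partialSignal]
  | insert i s hi ih =>
    have hne : ∀ j ∈ s, d i ^ η ≠ d j ^ η := fun j hj h => hi (hinj h ▸ hj)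
    have hSm := hN.measurable_partialSignal η d s
    have hHm := hN.measurable_clusterFading i
    have hOm := hN.measurable_clusterOn i
    have hHS : IndepFun (N.clusterFading i) (N.partialSignal η d s) P := by
      refine hN.indepFun (S := {.clusterFading i}) (T := clusterSources s) ?_
        (measurable_clusterFading_sigmaOf rfl) (measurable_partialSignal_sigmaOf η d s)
      rw [Set.disjoint_singleton_left]
      rintro (⟨j, hj, h⟩ | ⟨j, hj, h⟩)
      · simp at h
      · simp only [Source.clusterFading.injEq] at h
        exact hi (h ▸ hj)
    have hOHS : IndepFun (N.clusterOn i)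
        (fun w => (N.clusterFading i w, N.partialSignal η d s w)) P := by
      refine hN.indepFun (S := {.clusterOn i}) (T := {.clusterFading i} ∪ clusterSources s) ?_
        (measurable_clusterOn_sigmaOf rfl) ?_
      · rw [Set.disjoint_singleton_left]
        rintro (h | ⟨j, hj, h⟩ | ⟨j, hj, h⟩)
        · simp at h
        · simp only [Source.clusterOn.injEq] at h
          exact hi (h ▸ hj)
        · simp at h
      · exact (measurable_clusterFading_sigmaOf (Or.inl rfl)).prodMk
          ((measurable_partialSignal_sigmaOf η d s).mono
            (biSup_mono fun _ h => Or.inr h) le_rfl)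
    -- `A` is the tail event when the added transmitter `i` is active, `B` the one when it is
    -- silent; they carry the weights `p` and `1 - p`.
    set A : Set (ℝ × ℝ≥0∞) :=
      {q | ENNReal.ofReal x < ENNReal.ofReal ((d i ^ η)⁻¹ * q.1) + q.2}
    have hA : MeasurableSet A := measurableSet_lt measurable_const (by fun_prop)
    set B : Set (ℝ × ℝ≥0∞) := {q | ENNReal.ofReal x < q.2}
    have hB : MeasurableSet B := measurableSet_lt measurable_const measurable_snd
    have hsplit : {w | ENNReal.ofReal x < N.partialSignal η d (insert i s) w}
        = (N.clusterOn i ⁻¹' {true} ∩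
            (fun w => (N.clusterFading i w, N.partialSignal η d s w)) ⁻¹' A) ∪
          (N.clusterOn i ⁻¹' {false} ∩
            (fun w => (N.clusterFading i w, N.partialSignal η d s w)) ⁻¹' B) := by
      ext w
      cases hb : N.clusterOn i w <;>
        simp [A, B, partialSignal, Finset.sum_insert hi, hb, Real.rpow_neg (hd i).le]
    have hdisj : Disjoint (N.clusterOn i ⁻¹' {true} ∩
            (fun w => (N.clusterFading i w, N.partialSignal η d s w)) ⁻¹' A)
          (N.clusterOn i ⁻¹' {false} ∩
            (fun w => (N.clusterFading i w, N.partialSignal η d s w)) ⁻¹' B) := by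
      rw [Set.disjoint_left]
      rintro w ⟨h, _⟩ ⟨h', _⟩
      simp only [Set.mem_preimage, Set.mem_singleton_iff] at h h'
      rw [h] at h'
      cases h'
    have hpm : Measurable fun w => (N.clusterFading i w, N.partialSignal η d s w) :=
      hHm.prodMk hSm
    have hpt : P.real (N.clusterOn i ⁻¹' {true}) = prm.pTr := by
      have := hN.clusterOn_law i
      rw [Measure.real]
      exact (congrArg ENNReal.toReal this).trans (ENNReal.toReal_ofReal hprm.pTr_pos.le)
    have hpf : P.real (N.clusterOn i ⁻¹' {false}) = 1 - prm.pTr := by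
      have h : N.clusterOn i ⁻¹' {false} = (N.clusterOn i ⁻¹' {true})ᶜ := by ext w; simp
      rw [h, probReal_compl_eq_one_sub (hOm (measurableSet_singleton _)), hpt]
    have hind : ∀ (b : Bool) (C : Set (ℝ × ℝ≥0∞)), MeasurableSet C →
        P.real (N.clusterOn i ⁻¹' {b} ∩
            (fun w => (N.clusterFading i w, N.partialSignal η d s w)) ⁻¹' C)
          = P.real (N.clusterOn i ⁻¹' {b}) *
            P.real ((fun w => (N.clusterFading i w, N.partialSignal η d s w)) ⁻¹' C) := by
      intro b C hC
      simp only [Measure.real]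
      rw [hOHS.measure_inter_preimage_eq_mul _ _ (measurableSet_singleton b) hC,
        ENNReal.toReal_mul]
    rw [hsplit, measureReal_union hdisj ((hOm (measurableSet_singleton _)).inter (hpm hB)),
      hind _ _ hA, hind _ _ hB, hpt, hpf]
    have eA := prob_lt_exp_add hHm hSm hHS (hN.clusterFading_law i) (fun x hx => ih hx)
      (Real.rpow_pos_of_pos (hd i) η) hne hx
    have eB := ih hx
    have eA' : P.real ((fun w => (N.clusterFading i w, N.partialSignal η d s w)) ⁻¹' A) = _ := eA
    have eB' : P.real ((fun w => (N.clusterFading i w, N.partialSignal η d s w)) ⁻¹' B) = _ := eB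
    -- The new rate occurs only in the active case. For an old rate `a j` the factors combine to `p
    -- a_i / (a_i - a_j) + (1 - p) = (a_i - (1 - p) a_j) / (a_i - a_j)`.
    rw [eA', eB', Finset.sum_insert hi, tailCoeff_insert_self hi (hinj.injOn), mul_add,
      Finset.mul_sum, Finset.mul_sum, add_assoc, ← Finset.sum_add_distrib, mul_assoc]
    congr 1
    refine Finset.sum_congr rfl fun j hj => ?_
    rw [tailCoeff_insert_of_mem hi hj]
    have : d i ^ η - d j ^ η ≠ 0 := sub_ne_zero.2 (hne j hj)
    field_simp
    ring

end IsModel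

end Network

/-! ### Radial integrals -/

/-- Polar coordinates. Finiteness of the radial lower integral supplies the integrability needed to
pass through Bochner integrals. -/
lemma lintegral_radial_plane {f : ℝ → ℝ} (hf : Measurable f) (hf0 : ∀ u, 0 ≤ f u) {L : ℝ}
    (hL : 0 ≤ L) (h : ∫⁻ u in Set.Ioi (0 : ℝ), ENNReal.ofReal (u * f u) = ENNReal.ofReal L) :
    ∫⁻ x : Plane, ENNReal.ofReal (f ‖x‖) = ENNReal.ofReal (2 * Real.pi * L) := by
  have hm : AEStronglyMeasurable (fun u => u * f u) (volume.restrict (Set.Ioi 0)) :=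
    (measurable_id.mul hf).aestronglyMeasurable
  have h0 : 0 ≤ᵐ[volume.restrict (Set.Ioi 0)] fun u : ℝ => u * f u := by
    filter_upwards [ae_restrict_mem measurableSet_Ioi] with u hu
    exact mul_nonneg (le_of_lt hu) (hf0 u)
  have hi : IntegrableOn (fun u => u * f u) (Set.Ioi 0) := by
    refine ⟨hm, ?_⟩
    rw [hasFiniteIntegral_iff_ofReal h0, h]
    exact ENNReal.ofReal_lt_top
  have hv : ∫ u in Set.Ioi (0 : ℝ), u * f u = L := by
    rw [integral_eq_lintegral_of_nonneg_ae h0 hm, h, ENNReal.toReal_ofReal hL]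
  have hdim : Module.finrank ℝ Plane = 2 := by simp
  have hi' : Integrable (fun x : Plane => f ‖x‖) := by
    rw [integrable_fun_norm_addHaar (volume : Measure Plane), hdim]
    simpa using hi
  have hball : (volume : Measure Plane).real (Metric.ball 0 1) = Real.pi := by
    rw [Measure.real, EuclideanSpace.volume_ball_fin_two]
    simp [Real.pi_pos.le]
  rw [← ofReal_integral_eq_lintegral_ofReal hi' (Eventually.of_forall fun x => hf0 _),
    integral_fun_norm_addHaar (volume : Measure Plane) f, hdim, hball]
  congr 1
  simp only [Nat.add_one_sub_one, pow_one, smul_eq_mul, nsmul_eq_mul, hv, Nat.cast_ofNat]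
  ring

/-- With `b = 1 - 2/η` and `c = b + 1`, the factor `(1 - x)^(c - b - 1)` in Euler's integral is
trivial and the Gamma quotient collapses to `b`. -/
lemma hyperF_eq_integral {t η : ℝ} (hη : 2 < η) :
    hyperF t η = 2 * t / η * ∫ x in Set.Ioo (0 : ℝ) 1, x ^ (-(2 / η)) * (1 + t * x)⁻¹ := by
  have hη0 : η ≠ 0 := by linarith
  have hη2 : η - 2 ≠ 0 := by linarith
  have hb : 0 < 1 - 2 / η := by
    rw [sub_pos, div_lt_one (by linarith)]; exact hη
  have hG : Real.Gamma (2 - 2 / η) / (Real.Gamma (1 - 2 / η) *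
      Real.Gamma (2 - 2 / η - (1 - 2 / η))) = 1 - 2 / η := by
    rw [show 2 - 2 / η = (1 - 2 / η) + 1 by ring, Real.Gamma_add_one hb.ne',
      add_sub_cancel_left, Real.Gamma_one, mul_one, mul_div_assoc,
      div_self (Real.Gamma_pos_of_pos hb).ne', mul_one]
  rw [hyperF, gauss2F1, hG, intervalIntegral.integral_of_le zero_le_one,
    integral_Ioc_eq_integral_Ioo, ← mul_assoc]
  congr 1
  · field_simp
  · refine setIntegral_congr_fun measurableSet_Ioo fun x hx => ?_
    rw [show 2 - 2 / η - (1 - 2 / η) - 1 = 0 by ring, Real.rpow_zero, Real.rpow_neg_one,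
      show 1 - 2 / η - 1 = -(2 / η) by ring]
    ring

lemma hyperF_nonneg {t η : ℝ} (hη : 2 < η) (ht : 0 ≤ t) : 0 ≤ hyperF t η := by
  rw [hyperF_eq_integral hη]
  refine mul_nonneg (by positivity) (setIntegral_nonneg measurableSet_Ioo fun x hx => ?_)
  have := hx.1
  positivity

lemma image_rpow_neg_Ioi {η r : ℝ} (hη : 0 < η) (hr : 0 < r) :
    (fun u => (u / r) ^ (-η)) '' Set.Ioi r = Set.Ioo 0 1 := by
  ext x
  constructor
  · rintro ⟨u, hu, rfl⟩
    have h1 : 1 < u / r := by rw [lt_div_iff₀ hr]; simpa using hu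
    exact ⟨Real.rpow_pos_of_pos (by linarith) _, Real.rpow_lt_one_of_one_lt_of_neg h1 (by linarith)⟩
  · rintro ⟨h0, h1⟩
    refine ⟨r * x ^ (-η⁻¹), ?_, ?_⟩
    · have : 1 < x ^ (-η⁻¹) := Real.one_lt_rpow_of_pos_of_lt_one_of_neg h0 h1 (by
        rw [neg_lt_zero]; positivity)
      simp only [Set.mem_Ioi]
      nlinarith
    · simp only
      rw [mul_div_cancel_left₀ _ hr.ne', ← Real.rpow_mul h0.le, neg_mul_neg,
        inv_mul_cancel₀ hη.ne', Real.rpow_one]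

/-- The interference integral outside the disc of radius `r`. -/
lemma lintegral_guarded {η r t : ℝ} (hη : 2 < η) (hr : 0 < r) (ht : 0 ≤ t) :
    ∫⁻ u in Set.Ioi r, ENNReal.ofReal (u * (t * r ^ η * u ^ (-η) / (1 + t * r ^ η * u ^ (-η))))
      = ENNReal.ofReal (r ^ 2 / 2 * hyperF t η) := by
  have hη0 : 0 < η := by linarith
  -- The substitution `x = (u / r)^(-η)` maps `(r, ∞)` onto `(0, 1)` and turns `u du` into `(r² / η)
  -- x^(-2/η - 1) dx`, up to orientation; the integrand contributes `t x / (1 + t x)`.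
  set φ : ℝ → ℝ := fun u => (u / r) ^ (-η)
  set φ' : ℝ → ℝ := fun u => -η * (u / r) ^ (-η - 1) * r⁻¹
  set h : ℝ → ℝ := fun x => x ^ (-(2 / η)) * (1 + t * x)⁻¹
  have hpos : ∀ u ∈ Set.Ioi r, 0 < u / r := fun u hu => div_pos (hr.trans hu) hr
  have hφ' : ∀ u ∈ Set.Ioi r, HasDerivWithinAt φ (φ' u) (Set.Ioi r) u := by
    intro u hu
    have h1 : HasDerivAt (fun u => u / r) r⁻¹ u := by
      simpa [div_eq_mul_inv] using (hasDerivAt_id u).mul_const r⁻¹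
    refine (h1.rpow_const (p := -η) (Or.inl (hpos u hu).ne')).hasDerivWithinAt.congr_deriv ?_
    simp only [φ']
    ring
  have hinj : Set.InjOn φ (Set.Ioi r) := by
    intro u hu v hv huv
    have := Real.rpow_left_injOn (neg_ne_zero.2 hη0.ne') (hpos u hu).le (hpos v hv).le huv
    field_simp at this
    exact this
  have hcv := lintegral_image_eq_lintegral_abs_deriv_mul measurableSet_Ioi hφ' hinj
    (fun x => ENNReal.ofReal (r ^ 2 * t / η * h x))
  rw [image_rpow_neg_Ioi hη0 hr] at hcv
  have hint : IntegrableOn h (Set.Ioo 0 1) := by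
    have h1 : IntegrableOn (fun x : ℝ => x ^ (-(2 / η))) (Set.Ioo 0 1) := by
      refine ((intervalIntegrable_iff_integrableOn_Ioc_of_le zero_le_one).1
        (intervalIntegral.intervalIntegrable_rpow' ?_)).mono_set Set.Ioo_subset_Ioc_self
      rw [neg_lt_neg_iff, div_lt_one hη0]
      exact hη
    refine Integrable.mono' h1 (by fun_prop) ?_
    filter_upwards [ae_restrict_mem measurableSet_Ioo] with x hx
    have hx0 : 0 < x := hx.1
    rw [Real.norm_of_nonneg (by positivity)]
    refine mul_le_of_le_one_right (by positivity) (inv_le_one_of_one_le₀ ?_)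
    have : 0 ≤ t * x := by positivity
    linarith
  have hh0 : ∀ x ∈ Set.Ioo (0 : ℝ) 1, 0 ≤ r ^ 2 * t / η * h x := fun x hx => by
    have hx0 : 0 < x := hx.1
    simp only [h]; positivity
  rw [← ofReal_integral_eq_lintegral_ofReal (hint.const_mul _)
    ((ae_restrict_mem measurableSet_Ioo).mono hh0), integral_const_mul] at hcv
  rw [hyperF_eq_integral hη]
  refine Eq.trans ?_ (hcv.symm.trans ?_)
  · refine setLIntegral_congr_fun measurableSet_Ioi fun u hu => ?_
    have hu0 : 0 < u := hr.trans hu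
    have hv := hpos u hu
    have e1 : u ^ (-η) = r ^ (-η) * (u / r) ^ (-η) := by
      rw [← Real.mul_rpow hr.le hv.le, mul_div_cancel₀ _ hr.ne']
    have e2 : t * r ^ η * u ^ (-η) = t * (u / r) ^ (-η) := by
      rw [e1, Real.rpow_neg hr.le]
      have := (Real.rpow_pos_of_pos hr η).ne'
      field_simp
    have e3 : ((u / r) ^ (-η)) ^ (-(2 / η)) = (u / r) ^ 2 := by
      rw [← Real.rpow_mul hv.le, show -η * -(2 / η) = 2 by field_simp, Real.rpow_two]
    have e4 : (u / r) ^ (-η - 1) = (u / r) ^ (-η) * (u / r)⁻¹ := by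
      rw [Real.rpow_sub hv, Real.rpow_one]; rfl
    have hpv := Real.rpow_pos_of_pos hv (-η)
    have hne : 1 + t * (u / r) ^ (-η) ≠ 0 := by positivity
    simp only [φ', φ, h]
    rw [← ENNReal.ofReal_mul (abs_nonneg _), e2, e3,
      show |-η * (u / r) ^ (-η - 1) * r⁻¹| = η * (u / r) ^ (-η - 1) * r⁻¹ by
        rw [abs_mul, abs_mul, abs_neg, abs_of_pos hη0, abs_of_pos (Real.rpow_pos_of_pos hv _),
          abs_of_pos (inv_pos.2 hr)], e4]
    congr 1
    generalize (u / r) ^ (-η) = y at *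
    field_simp
  · congr 1
    ring

/-- Write `s u^(-η) / (1 + s u^(-η)) = 1 / (1 + u^η / s)` as `∫ exp(-(1 + u^η / s) h) dh` and apply
Tonelli. The integral in `u` gives `Γ(1 + 2/η)` and a power of `h`; the remaining integral in `h` is
`Γ(1 - 2/η)`, convergent because `η > 2`. -/
lemma lintegral_unguarded {η s : ℝ} (hη : 2 < η) (hs : 0 < s) :
    ∫⁻ u in Set.Ioi (0 : ℝ), ENNReal.ofReal (u * (s * u ^ (-η) / (1 + s * u ^ (-η))))
      = ENNReal.ofReal (s ^ (2 / η) * Real.Gamma (1 + 2 / η) * Real.Gamma (1 - 2 / η) / 2) := by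
  have hη0 : 0 < η := by linarith
  have hb : 0 < 1 - 2 / η := by
    rw [sub_pos, div_lt_one hη0]; exact hη
  have h1 : ∀ u ∈ Set.Ioi (0 : ℝ),
      ENNReal.ofReal (u * (s * u ^ (-η) / (1 + s * u ^ (-η))))
        = ∫⁻ h in Set.Ioi (0 : ℝ), ENNReal.ofReal (u * Real.exp (-((1 + s⁻¹ * u ^ η) * h))) := by
    intro u hu
    have hu0 : (0 : ℝ) < u := hu
    have hp := Real.rpow_pos_of_pos hu0 η
    simp_rw [ENNReal.ofReal_mul hu0.le]
    rw [lintegral_const_mul' _ _ ENNReal.ofReal_ne_top, lintegral_exp_neg_mul_Ioi (by positivity),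
      Real.rpow_neg hu0.le]
    congr 2
    field_simp
    ring
  have h2 : ∀ h ∈ Set.Ioi (0 : ℝ),
      ∫⁻ u in Set.Ioi (0 : ℝ), ENNReal.ofReal (u * Real.exp (-((1 + s⁻¹ * u ^ η) * h)))
        = ENNReal.ofReal (s ^ (2 / η) * Real.Gamma (1 + 2 / η) / 2 *
            (Real.exp (-h) * h ^ (1 - 2 / η - 1))) := by
    intro h hh
    have hh0 : (0 : ℝ) < h := hh
    have e : ∀ u : ℝ, u * Real.exp (-((1 + s⁻¹ * u ^ η) * h))
        = Real.exp (-h) * (u ^ (1 : ℝ) * Real.exp (-(s⁻¹ * h) * u ^ η)) := by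
      intro u
      rw [Real.rpow_one, mul_left_comm, ← Real.exp_add]
      congr 2; ring
    have hv := integral_rpow_mul_exp_neg_mul_rpow hη0 (by norm_num : (-1 : ℝ) < 1)
      (by positivity : 0 < s⁻¹ * h)
    have hpos : 0 < (s⁻¹ * h) ^ (-(1 + 1) / η) * (1 / η) * Real.Gamma ((1 + 1) / η) := by
      have := Real.Gamma_pos_of_pos (by positivity : 0 < (1 + 1) / η)
      positivity
    have hi : IntegrableOn (fun u : ℝ => u ^ (1 : ℝ) * Real.exp (-(s⁻¹ * h) * u ^ η))
        (Set.Ioi 0) := by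
      -- A non-integrable function has Bochner integral 0 by convention, which contradicts the
      -- positive value just computed.
      by_contra hc
      rw [integral_undef hc] at hv
      exact hpos.ne hv
    simp_rw [e]
    rw [← ofReal_integral_eq_lintegral_ofReal (hi.const_mul _), integral_const_mul, hv]
    · congr 1
      rw [add_comm (1 : ℝ) (2 / η), Real.Gamma_add_one (by positivity),
        Real.mul_rpow (by positivity) hh0.le, Real.inv_rpow hs.le, ← Real.rpow_neg hs.le,
        show 1 - 2 / η - 1 = -(1 + 1) / η by ring, show -(-(1 + 1) / η) = 2 / η by ring,
        show (1 + 1 : ℝ) / η = 2 / η by norm_num]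
      ring
    · filter_upwards [ae_restrict_mem measurableSet_Ioi] with u hu
      have : (0 : ℝ) < u := hu
      positivity
  rw [setLIntegral_congr_fun measurableSet_Ioi h1, lintegral_lintegral_swap (by fun_prop),
    setLIntegral_congr_fun measurableSet_Ioi h2,
    ← ofReal_integral_eq_lintegral_ofReal ((Real.GammaIntegral_convergent hb).const_mul _),
    integral_const_mul, ← Real.Gamma_eq_integral hb]
  · congr 1; ring
  · filter_upwards [ae_restrict_mem measurableSet_Ioi] with h hh
    have hh0 : (0 : ℝ) < h := hh
    have := Real.Gamma_pos_of_pos (by positivity : 0 < 1 + 2 / η)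
    positivity

lemma div_one_add_nonneg {x : ℝ} (hx : 0 ≤ x) : 0 ≤ x / (1 + x) := by positivity

/-- Interference integral of the transmitter tier, with guard zone of radius `r`. -/
lemma lintegral_plane_guarded {η r t : ℝ} (hη : 2 < η) (hr : 0 < r) (ht : 0 ≤ t) :
    ∫⁻ x : Plane, ENNReal.ofReal
        ((if r < ‖x‖ then t * r ^ η * ‖x‖ ^ (-η) else 0) /
          (1 + if r < ‖x‖ then t * r ^ η * ‖x‖ ^ (-η) else 0))
      = ENNReal.ofReal (Real.pi * r ^ 2 * hyperF t η) := by
  set g : ℝ → ℝ := fun u => if r < u then t * r ^ η * u ^ (-η) else 0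
  have hg : Measurable g := Measurable.ite measurableSet_Ioi (by fun_prop) measurable_const
  have hg0 : ∀ u, 0 ≤ g u := by
    intro u
    simp only [g]
    split_ifs with h
    · have : 0 < u := hr.trans h
      positivity
    · exact le_rfl
  have hF := hyperF_nonneg hη ht
  rw [show Real.pi * r ^ 2 * hyperF t η = 2 * Real.pi * (r ^ 2 / 2 * hyperF t η) by ring]
  refine lintegral_radial_plane (f := fun u => g u / (1 + g u))
    (hg.div (measurable_const.add hg)) (fun u => div_one_add_nonneg (hg0 u)) (by positivity) ?_
  rw [← lintegral_guarded hη hr ht, ← lintegral_indicator measurableSet_Ioi,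
    ← lintegral_indicator measurableSet_Ioi]
  refine lintegral_congr fun u => ?_
  by_cases h : r < u
  · have : 0 < u := hr.trans h
    simp [g, h, this]
  · by_cases h' : 0 < u <;> simp [g, h, h']

/-- Interference integral of an extrinsic tier. -/
lemma lintegral_plane_unguarded {η s : ℝ} (hη : 2 < η) (hs : 0 ≤ s) :
    ∫⁻ x : Plane, ENNReal.ofReal (s * ‖x‖ ^ (-η) / (1 + s * ‖x‖ ^ (-η)))
      = ENNReal.ofReal
          (Real.pi * (s ^ (2 / η) * Real.Gamma (1 + 2 / η) * Real.Gamma (1 - 2 / η))) := by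
  have hη0 : 0 < η := by linarith
  rcases hs.eq_or_lt with rfl | hs
  · simp [Real.zero_rpow (by positivity : 2 / η ≠ 0)]
  have hb : 0 < 1 - 2 / η := by
    rw [sub_pos, div_lt_one hη0]; exact hη
  have hG := Real.Gamma_pos_of_pos hb
  have hG' := Real.Gamma_pos_of_pos (by positivity : 0 < 1 + 2 / η)
  -- The polar coordinate lemma wants nonnegativity on all of `ℝ`, but real powers of negative
  -- numbers can be negative; only `u ≥ 0` matters for norms.
  set f : ℝ → ℝ := fun u => if 0 ≤ u then s * u ^ (-η) / (1 + s * u ^ (-η)) else 0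
  have hf : Measurable f := Measurable.ite measurableSet_Ici (by fun_prop) measurable_const
  have hf0 : ∀ u, 0 ≤ f u := by
    intro u
    simp only [f]
    split_ifs with h
    · exact div_one_add_nonneg (by positivity)
    · exact le_rfl
  have := lintegral_radial_plane hf hf0
    (L := s ^ (2 / η) * Real.Gamma (1 + 2 / η) * Real.Gamma (1 - 2 / η) / 2) (by positivity) (by
      rw [← lintegral_unguarded hη hs]
      refine setLIntegral_congr_fun measurableSet_Ioi fun u hu => ?_
      simp [f, le_of_lt (Set.mem_Ioi.1 hu)])
  simp only [f, norm_nonneg, if_true] at this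
  rw [this]
  congr 1
  ring

/-! ### The distance to the `K`-th nearest point -/

/-- Probability that a Poisson variable of mean `u` is less than `K`. -/
def poissonTail (K : ℕ) (u : ℝ) : ℝ :=
  ∑ k ∈ Finset.range K, Real.exp (-u) * u ^ k / k.factorial

lemma continuous_poissonTail (K : ℕ) : Continuous (poissonTail K) := by
  unfold poissonTail; fun_prop

lemma poissonTail_zero {K : ℕ} (hK : 0 < K) : poissonTail K 0 = 1 := by
  rw [poissonTail, Finset.sum_eq_single_of_mem 0 (Finset.mem_range.2 hK)]
  · simp
  · intro k _ hk
    simp [hk]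

/-- The derivative of the sum telescopes, so only its last term survives. -/
lemma hasDerivAt_poissonTail (K : ℕ) (u : ℝ) :
    HasDerivAt (poissonTail (K + 1)) (-(Real.exp (-u) * u ^ K / K.factorial)) u := by
  induction K with
  | zero =>
    have h : poissonTail (0 + 1) = fun u => Real.exp (-u) := by
      ext u; simp [poissonTail]
    rw [h]
    simpa using (hasDerivAt_id u).neg.exp
  | succ K ih =>
    have h : poissonTail (K + 1 + 1) = fun u =>
        poissonTail (K + 1) u + Real.exp (-u) * u ^ (K + 1) / (K + 1).factorial := by
      ext u; rw [poissonTail, Finset.sum_range_succ]; rfl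
    rw [h]
    refine (ih.add (((hasDerivAt_id u).neg.exp.mul (hasDerivAt_pow (K + 1) u)).div_const
      ((K + 1).factorial : ℝ))).congr_deriv ?_
    have : ((K + 1).factorial : ℝ) = (K + 1) * K.factorial := by
      rw [Nat.factorial_succ]; push_cast; ring
    rw [this]
    have hf : (K.factorial : ℝ) ≠ 0 := by positivity
    have hk : (K + 1 : ℝ) ≠ 0 := by positivity
    simp only [Pi.neg_apply, id, Nat.add_sub_cancel]
    push_cast
    field_simp
    ring

lemma tendsto_poissonTail (K : ℕ) : Tendsto (poissonTail K) atTop (𝓝 0) := by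
  have : Tendsto (fun u : ℝ => ∑ k ∈ Finset.range K, u ^ k * Real.exp (-u) / k.factorial) atTop
      (𝓝 (∑ k ∈ Finset.range K, 0 / (k.factorial : ℝ))) :=
    tendsto_finsetSum _ fun k _ =>
      (Real.tendsto_pow_mul_exp_neg_atTop_nhds_zero k).div_const _
  simp only [zero_div, Finset.sum_const_zero] at this
  refine this.congr fun u => Finset.sum_congr rfl fun k _ => by ring

lemma poissonTail_nonneg (K : ℕ) {u : ℝ} (hu : 0 ≤ u) : 0 ≤ poissonTail K u :=
  Finset.sum_nonneg fun k _ => by positivity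

lemma poissonMeasure_Iio (K : ℕ) (μ : ℝ≥0) :
    ∑ k ∈ Finset.range K, poissonMeasure μ {k} = ENNReal.ofReal (poissonTail K μ) := by
  rw [poissonTail, ENNReal.ofReal_sum_of_nonneg (fun k _ => by positivity)]
  exact Finset.sum_congr rfl fun k _ => poissonMeasure_singleton μ k

lemma distDensity_nonneg (K : ℕ) {ρ : ℝ} (hρ : 0 ≤ ρ) (r : ℝ) : 0 ≤ distDensity K ρ r := by
  unfold distDensity
  split_ifs with h
  · have := Real.Gamma_nonneg_of_nonneg (Nat.cast_nonneg (α := ℝ) K)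
    positivity
  · exact le_rfl

lemma measurable_distDensity (K : ℕ) (ρ : ℝ) : Measurable (distDensity K ρ) := by
  unfold distDensity
  exact Measurable.ite measurableSet_Ioi (by fun_prop) measurable_const

/-- On `r > 0` the density is the derivative of `1 - poissonTail K (ρ π r²)`, so this is the
fundamental theorem of calculus; `Γ(K) = (K - 1)!` matches the constants. -/
lemma setLIntegral_distDensity {K : ℕ} (hK : 0 < K) {ρ : ℝ} (hρ : 0 < ρ) {r : ℝ} (hr : 0 ≤ r) :
    ∫⁻ x in Set.Iic r, ENNReal.ofReal (distDensity K ρ x)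
      = ENNReal.ofReal (1 - poissonTail K (ρ * (Real.pi * r ^ 2))) := by
  obtain ⟨k, rfl⟩ := Nat.exists_eq_succ_of_ne_zero hK.ne'
  set g : ℝ → ℝ := fun x => 2 * (ρ * Real.pi) * x * (Real.exp (-(ρ * (Real.pi * x ^ 2))) *
    (ρ * (Real.pi * x ^ 2)) ^ k / k.factorial)
  have hg0 : ∀ x, 0 ≤ x → 0 ≤ g x := fun x hx => by
    simp only [g]; have := Real.pi_pos; positivity
  have hgc : Continuous g := by simp only [g]; fun_prop
  have h1 : ∫⁻ x in Set.Iic r, ENNReal.ofReal (distDensity (k + 1) ρ x)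
      = ∫⁻ x in Set.Ioc 0 r, ENNReal.ofReal (g x) := by
    rw [← lintegral_indicator measurableSet_Iic, ← lintegral_indicator measurableSet_Ioc]
    refine lintegral_congr fun x => ?_
    by_cases hx0 : 0 < x
    · by_cases hxr : x ≤ r
      · simp only [Set.indicator, Set.mem_Iic, Set.mem_Ioc, hx0, hxr, and_self, if_true,
          distDensity]
        congr 1
        have : Real.Gamma ((k + 1 : ℕ) : ℝ) = k.factorial := by
          push_cast; exact Real.Gamma_nat_eq_factorial k
        rw [this]
        simp only [g]
        rw [pow_succ (ρ * Real.pi * x ^ 2) k, ← mul_assoc ρ]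
        field_simp
      · simp [Set.indicator, hxr]
    · by_cases hxr : x ≤ r <;> simp [Set.indicator, hx0, distDensity]
  have hd : ∀ x ∈ Set.uIcc 0 r,
      HasDerivAt (fun x => -poissonTail (k + 1) (ρ * (Real.pi * x ^ 2))) (g x) x := by
    intro x _
    have h2 : HasDerivAt (fun x : ℝ => ρ * (Real.pi * x ^ 2)) (ρ * (Real.pi * (2 * x))) x := by
      simpa using ((hasDerivAt_pow 2 x).const_mul Real.pi).const_mul ρ
    refine ((hasDerivAt_poissonTail k _).comp x h2).neg.congr_deriv ?_
    simp only [g]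
    ring
  have h3 := intervalIntegral.integral_eq_sub_of_hasDerivAt hd (hgc.intervalIntegrable _ _)
  rw [h1, ← ofReal_integral_eq_lintegral_ofReal]
  · rw [← intervalIntegral.integral_of_le hr, h3]
    simp only [ne_eq, OfNat.ofNat_ne_zero, not_false_eq_true, zero_pow, mul_zero]
    rw [poissonTail_zero (Nat.succ_pos k)]
    congr 1
    ring
  · exact (intervalIntegrable_iff_integrableOn_Ioc_of_le hr).1 (hgc.intervalIntegrable _ _)
  · filter_upwards [ae_restrict_mem measurableSet_Ioc] with x hx
    exact hg0 x hx.1.le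

lemma tendsto_poissonTail_radius (K : ℕ) {ρ : ℝ} (hρ : 0 < ρ) :
    Tendsto (fun r : ℝ => poissonTail K (ρ * (Real.pi * r ^ 2))) atTop (𝓝 0) :=
  (tendsto_poissonTail K).comp <| ((tendsto_pow_atTop two_ne_zero).const_mul_atTop
    Real.pi_pos).const_mul_atTop hρ

lemma lintegral_distDensity {K : ℕ} (hK : 0 < K) {ρ : ℝ} (hρ : 0 < ρ) :
    ∫⁻ x, ENNReal.ofReal (distDensity K ρ x) = 1 := by
  have h1 := tendsto_measure_Iic_atTop
    (volume.withDensity fun r => ENNReal.ofReal (distDensity K ρ r))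
  rw [withDensity_apply _ MeasurableSet.univ, setLIntegral_univ] at h1
  refine tendsto_nhds_unique h1 ?_
  have h2 : Tendsto (fun r : ℝ => ENNReal.ofReal (1 - poissonTail K (ρ * (Real.pi * r ^ 2))))
      atTop (𝓝 (ENNReal.ofReal (1 - 0))) :=
    ENNReal.tendsto_ofReal ((tendsto_poissonTail_radius K hρ).const_sub 1)
  rw [sub_zero, ENNReal.ofReal_one] at h2
  refine h2.congr' ?_
  filter_upwards [eventually_ge_atTop 0] with r hr
  rw [withDensity_apply _ measurableSet_Iic, setLIntegral_distDensity hK hρ hr]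

lemma integral_distDensity {K : ℕ} (hK : 0 < K) {ρ : ℝ} (hρ : 0 < ρ) :
    ∫ x, distDensity K ρ x = 1 := by
  rw [integral_eq_lintegral_of_nonneg_ae
    (Eventually.of_forall fun x => distDensity_nonneg K hρ.le x)
    (measurable_distDensity K ρ).aestronglyMeasurable, lintegral_distDensity hK hρ,
    ENNReal.toReal_one]

/-- Averaging a Gaussian factor over the law of the distance to the `K`-th nearest point. -/
lemma integral_exp_withDensity_distDensity {K : ℕ} (hK : 0 < K) {ρ c : ℝ} (hρ : 0 < ρ)
    (hc : 0 ≤ c) :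
    ∫ r, Real.exp (-(ρ * Real.pi * r ^ 2 * c))
        ∂(volume.withDensity fun r => ENNReal.ofReal (distDensity K ρ r))
      = ((1 + c) ^ K)⁻¹ := by
  rw [integral_withDensity_eq_integral_toReal_smul (measurable_distDensity K ρ).ennreal_ofReal
    (Eventually.of_forall fun _ => ENNReal.ofReal_lt_top)]
  -- The Gaussian factor merges with the exponential of the density, giving the same density with
  -- parameter `ρ (1 + c)` up to the factor `(1 + c)^K`. The latter density has mass one.
  have h : ∀ r, (ENNReal.ofReal (distDensity K ρ r)).toReal •
      Real.exp (-(ρ * Real.pi * r ^ 2 * c)) = ((1 + c) ^ K)⁻¹ * distDensity K (ρ * (1 + c)) r := by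
    intro r
    rw [ENNReal.toReal_ofReal (distDensity_nonneg K hρ.le r), smul_eq_mul]
    unfold distDensity
    split_ifs with hr
    · have h1 : -(ρ * (1 + c) * Real.pi * r ^ 2)
          = -(ρ * Real.pi * r ^ 2) + -(ρ * Real.pi * r ^ 2 * c) := by ring
      have h2 : (ρ * (1 + c) * Real.pi * r ^ 2) ^ K
          = (1 + c) ^ K * (ρ * Real.pi * r ^ 2) ^ K := by rw [← mul_pow]; ring
      have h3 : (1 + c) ^ K ≠ 0 := by positivity
      rw [h1, h2, Real.exp_add]
      field_simp
    · simp
  simp_rw [h]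
  rw [integral_const_mul, integral_distDensity hK (by positivity), mul_one]

lemma kthNearest_nonneg (K : ℕ) (x : ℕ → Plane) : 0 ≤ kthNearest K x :=
  Real.sInf_nonneg fun _ h => h.1

lemma pointCount_mono (x : ℕ → Plane) {A B : Set Plane} (h : A ⊆ B) :
    pointCount x A ≤ pointCount x B :=
  Set.encard_le_encard fun _ hn => h hn

lemma pointCount_closedBall_mono (x : ℕ → Plane) {r s : ℝ} (h : r ≤ s) :
    pointCount x (Metric.closedBall 0 r) ≤ pointCount x (Metric.closedBall 0 s) :=
  pointCount_mono x (Metric.closedBall_subset_closedBall h)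

lemma kthNearest_le {K : ℕ} {x : ℕ → Plane} {r : ℝ} (hr : 0 ≤ r)
    (h : (K : ℕ∞) ≤ pointCount x (Metric.closedBall 0 r)) : kthNearest K x ≤ r := by
  unfold kthNearest
  exact csInf_le ⟨0, fun _ h => h.1⟩ ⟨hr, h⟩

/-- The second hypothesis excludes configurations with fewer than `K` points, where `sInf ∅ = 0`
makes `kthNearest` meaningless. -/
lemma le_pointCount_of_kthNearest_lt {K : ℕ} {x : ℕ → Plane} {r : ℝ} (hr : kthNearest K x < r)
    (hne : ∃ n : ℕ, (K : ℕ∞) ≤ pointCount x (Metric.closedBall 0 n)) :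
    (K : ℕ∞) ≤ pointCount x (Metric.closedBall 0 r) := by
  obtain ⟨n, hn⟩ := hne
  obtain ⟨s, ⟨_, hs⟩, hsr⟩ := exists_lt_of_csInf_lt
    (s := {r : ℝ | 0 ≤ r ∧ (K : ℕ∞) ≤ pointCount x (Metric.closedBall 0 r)})
    ⟨(n : ℝ), Nat.cast_nonneg n, hn⟩ hr
  exact hs.trans (pointCount_closedBall_mono x hsr.le)

lemma kthNearest_of_forall_lt {K : ℕ} {x : ℕ → Plane}
    (h : ∀ n : ℕ, ¬ (K : ℕ∞) ≤ pointCount x (Metric.closedBall 0 n)) : kthNearest K x = 0 := by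
  have : {r : ℝ | 0 ≤ r ∧ (K : ℕ∞) ≤ pointCount x (Metric.closedBall 0 r)} = ∅ := by
    ext r
    simp only [Set.mem_ofPred_eq, Set.mem_empty_iff_false, iff_false, not_and]
    intro _ hr
    obtain ⟨n, hn⟩ := exists_nat_ge r
    exact h n (hr.trans (pointCount_closedBall_mono x hn))
  rw [kthNearest, this, Real.sInf_empty]

namespace IsHomogeneousPPP

variable {Ω : Type*} [MeasurableSpace Ω] {P : Measure Ω} {X : ℕ → Ω → Plane} {ρ : ℝ}

lemma measurableSet_le_pointCount (h : IsHomogeneousPPP P X ρ) (K : ℕ) (r : ℝ) :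
    MeasurableSet {w | (K : ℕ∞) ≤ pointCount (fun n => X n w) (Metric.closedBall 0 r)} :=
  h.measurable_pointCount Metric.isClosed_closedBall.measurableSet
    (MeasurableSet.of_discrete (s := Set.Ici (K : ℕ∞)))

lemma measurable_kthNearest (h : IsHomogeneousPPP P X ρ) (K : ℕ) :
    Measurable fun w => kthNearest K fun n => X n w := by
  refine measurable_of_Iio fun c => ?_
  rcases le_or_gt c 0 with hc | hc
  · convert MeasurableSet.empty
    ext w
    simpa using hc.trans (kthNearest_nonneg _ _)
  -- For `c > 0`, rational radii below `c` detect the generic configurations. The intersection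
  -- collects those with fewer than `K` points in every disc, whose default value 0 is also below
  -- `c`.
  have : (fun w => kthNearest K fun n => X n w) ⁻¹' Set.Iio c
      = (⋃ q : {q : ℚ // 0 ≤ q ∧ (q : ℝ) < c},
          {w | (K : ℕ∞) ≤ pointCount (fun n => X n w) (Metric.closedBall 0 (q : ℝ))}) ∪
        ⋂ n : ℕ, {w | (K : ℕ∞) ≤ pointCount (fun n => X n w) (Metric.closedBall 0 (n : ℝ))}ᶜ := by
    ext w
    simp only [Set.mem_preimage, Set.mem_Iio, Set.mem_union, Set.mem_iUnion, Set.mem_ofPred_eq,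
      Set.mem_iInter, Set.mem_compl_iff]
    constructor
    · intro hw
      by_cases hne : ∃ n : ℕ, (K : ℕ∞) ≤ pointCount (fun n => X n w) (Metric.closedBall 0 n)
      · obtain ⟨q, hq, hqc⟩ := exists_rat_btwn hw
        have hq0 : (0 : ℝ) ≤ q := (kthNearest_nonneg _ _).trans hq.le
        exact Or.inl ⟨⟨q, by exact_mod_cast hq0, hqc⟩, le_pointCount_of_kthNearest_lt hq hne⟩
      · exact Or.inr fun n hn => hne ⟨n, hn⟩
    · rintro (⟨⟨q, hq, hqc⟩, hw⟩ | hw)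
      · exact (kthNearest_le (by exact_mod_cast hq) hw).trans_lt hqc
      · rw [kthNearest_of_forall_lt hw]; exact hc
  rw [this]
  exact (MeasurableSet.iUnion fun q => h.measurableSet_le_pointCount K _).union
    (MeasurableSet.iInter fun n => (h.measurableSet_le_pointCount K _).compl)

lemma prob_pointCount_lt (h : IsHomogeneousPPP P X ρ) (hρ : 0 ≤ ρ) (K : ℕ) {r : ℝ} (hr : 0 ≤ r) :
    P {w | (K : ℕ∞) ≤ pointCount (fun n => X n w) (Metric.closedBall 0 r)}ᶜ
      = ENNReal.ofReal (poissonTail K (ρ * (Real.pi * r ^ 2))) := by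
  have hB : MeasurableSet (Metric.closedBall (0 : Plane) r) :=
    Metric.isClosed_closedBall.measurableSet
  have hv : (volume (Metric.closedBall (0 : Plane) r)).toReal = Real.pi * r ^ 2 := by
    rw [EuclideanSpace.volume_closedBall_fin_two]
    simp [hr, Real.pi_pos.le, mul_comm]
  have hset : {w | (K : ℕ∞) ≤ pointCount (fun n => X n w) (Metric.closedBall 0 r)}ᶜ
      = ⋃ k ∈ Finset.range K, {w | pointCount (fun n => X n w) (Metric.closedBall 0 r) = k} := by
    ext w
    simp only [Set.mem_compl_iff, Set.mem_ofPred_eq, not_le, Finset.mem_range, Set.mem_iUnion,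
      exists_prop]
    constructor
    · intro hw
      lift pointCount (fun n => X n w) (Metric.closedBall 0 r) to ℕ using hw.ne_top with k
      exact ⟨k, by exact_mod_cast hw, rfl⟩
    · rintro ⟨k, hk, hw⟩
      rw [hw]; exact_mod_cast hk
  rw [hset, measure_biUnion_finset]
  · have hμ : 0 ≤ ρ * (Real.pi * r ^ 2) := by have := Real.pi_pos; positivity
    have := poissonMeasure_Iio K (ρ * (Real.pi * r ^ 2)).toNNReal
    rw [Real.coe_toNNReal _ hμ] at this
    rw [← this]
    refine Finset.sum_congr rfl fun k _ => ?_
    rw [h.poisson _ hB measure_closedBall_lt_top.ne k, hv]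
  · intro i _ j _ hij
    rw [Function.onFun, Set.disjoint_left]
    intro w hw hw'
    simp only [Set.mem_ofPred_eq] at hw hw'
    exact hij (by exact_mod_cast hw.symm.trans hw')
  · exact fun k _ => h.measurable_pointCount hB (measurableSet_singleton _)

lemma prob_le_pointCount [IsProbabilityMeasure P] (h : IsHomogeneousPPP P X ρ) (hρ : 0 ≤ ρ)
    (K : ℕ) {r : ℝ} (hr : 0 ≤ r) :
    P {w | (K : ℕ∞) ≤ pointCount (fun n => X n w) (Metric.closedBall 0 r)}
      = ENNReal.ofReal (1 - poissonTail K (ρ * (Real.pi * r ^ 2))) := by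
  have hμ : 0 ≤ ρ * (Real.pi * r ^ 2) := by have := Real.pi_pos; positivity
  rw [← compl_compl {w | (K : ℕ∞) ≤ pointCount (fun n => X n w) (Metric.closedBall 0 r)},
    prob_compl_eq_one_sub (h.measurableSet_le_pointCount K r).compl, h.prob_pointCount_lt hρ K hr,
    ENNReal.ofReal_sub _ (poissonTail_nonneg K hμ), ENNReal.ofReal_one]

lemma ae_exists_le_pointCount (h : IsHomogeneousPPP P X ρ) (hρ : 0 < ρ) (K : ℕ) :
    ∀ᵐ w ∂P, ∃ n : ℕ, (K : ℕ∞) ≤ pointCount (fun n => X n w) (Metric.closedBall 0 n) := by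
  rw [ae_iff]
  have h1 : Tendsto (fun n : ℕ =>
      ENNReal.ofReal (poissonTail K (ρ * (Real.pi * (n : ℝ) ^ 2)))) atTop (𝓝 0) := by
    have := ENNReal.tendsto_ofReal
      ((tendsto_poissonTail_radius K hρ).comp tendsto_natCast_atTop_atTop)
    rwa [ENNReal.ofReal_zero] at this
  refine le_antisymm (ge_of_tendsto' h1 fun n => ?_) zero_le
  rw [← h.prob_pointCount_lt hρ.le K (Nat.cast_nonneg n)]
  exact measure_mono fun w hw hn => hw ⟨n, hn⟩

/-- The law of the distance to the `K`-th nearest point. -/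
theorem map_kthNearest [IsProbabilityMeasure P] (h : IsHomogeneousPPP P X ρ) (hρ : 0 < ρ) {K : ℕ}
    (hK : 0 < K) :
    P.map (fun w => kthNearest K fun n => X n w) =
      volume.withDensity fun r => ENNReal.ofReal (distDensity K ρ r) := by
  have hm := h.measurable_kthNearest K
  have : IsProbabilityMeasure (P.map fun w => kthNearest K fun n => X n w) :=
    Measure.isProbabilityMeasure_map hm.aemeasurable
  refine Measure.ext_of_Iic _ _ fun r => ?_
  rw [Measure.map_apply hm measurableSet_Iic, withDensity_apply _ measurableSet_Iic]
  rcases lt_or_ge r 0 with hr | hr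
  · have h1 : (fun w => kthNearest K fun n => X n w) ⁻¹' Set.Iic r = ∅ := by
      ext w
      simpa using hr.trans_le (kthNearest_nonneg _ _)
    rw [h1, measure_empty, setLIntegral_congr_fun (g := fun _ => 0) measurableSet_Iic]
    · simp
    · intro x hx
      have : ¬ 0 < x := not_lt.2 ((Set.mem_Iic.1 hx).trans hr.le)
      simp [distDensity, this]
  · rw [setLIntegral_distDensity hK hρ hr]
    apply le_antisymm
    -- For the upper bound, `kthNearest ≤ r` almost surely puts `K` points into every slightly
    -- larger disc; letting the radius decrease to `r` avoids proving that the infimum is attained.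
    · have h2 : Tendsto (fun n : ℕ => ENNReal.ofReal (1 - poissonTail K
          (ρ * (Real.pi * (r + 1 / ((n : ℝ) + 1)) ^ 2)))) atTop
          (𝓝 (ENNReal.ofReal (1 - poissonTail K (ρ * (Real.pi * r ^ 2))))) := by
        have hc : Continuous fun x : ℝ =>
            ENNReal.ofReal (1 - poissonTail K (ρ * (Real.pi * (r + x) ^ 2))) := by
          have := continuous_poissonTail K
          exact ENNReal.continuous_ofReal.comp (by fun_prop)
        have := (hc.tendsto 0).comp tendsto_one_div_add_atTop_nhds_zero_nat
        simpa [Function.comp_def] using this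
      refine ge_of_tendsto' h2 fun n => ?_
      have hn : 0 < 1 / ((n : ℝ) + 1) := by positivity
      rw [← h.prob_le_pointCount hρ.le K (by linarith)]
      refine measure_mono_ae ?_
      filter_upwards [h.ae_exists_le_pointCount hρ K] with w hw hle
      exact le_pointCount_of_kthNearest_lt (lt_of_le_of_lt hle (by linarith)) hw
    · rw [← h.prob_le_pointCount hρ.le K hr]
      exact measure_mono fun w hw => kthNearest_le hr hw

end IsHomogeneousPPP

/-! ### The coefficients of the closed form -/

/-- Scale invariance: this is why the coefficients see only the normalized geometry and not `d_K`.
-/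
lemma tailCoeff_const_mul {ι : Type*} [DecidableEq ι] (p : ℝ) (a : ι → ℝ) (s : Finset ι) (j : ι)
    {c : ℝ} (hc : c ≠ 0) : tailCoeff p (fun i => a i * c) s j = tailCoeff p a s j := by
  unfold tailCoeff
  congr 1
  refine Finset.prod_congr rfl fun l _ => ?_
  rw [← mul_assoc, ← sub_mul, ← sub_mul, mul_div_mul_right _ _ hc]

namespace NetworkParams

variable {K M : ℕ} {prm : NetworkParams K M}

/-- Vieta: the `α_i` are signed elementary symmetric functions of the `ω_l^η`. -/
lemma sum_alpha_mul_pow (prm : NetworkParams K M) (y : ℝ) :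
    ∑ i ∈ Finset.range (K + 1), prm.alpha i * y ^ i = ∏ l, (prm.ω l ^ prm.η - y) := by
  simp_rw [sub_eq_add_neg]
  rw [Finset.prod_add, Finset.sum_powerset, Finset.card_univ, Fintype.card_fin,
    ← Finset.sum_range_reflect]
  refine Finset.sum_congr rfl fun i hi => ?_
  have hi' : i ≤ K := Nat.lt_succ_iff.1 (Finset.mem_range.1 hi)
  rw [Nat.add_sub_cancel, alpha, Nat.sub_sub_self hi', Finset.mul_sum, Finset.sum_mul]
  refine Finset.sum_congr rfl fun t ht => ?_
  have hc := (Finset.mem_powersetCard.1 ht).2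
  rw [Finset.prod_const, Finset.card_sdiff_of_subset (Finset.subset_univ t), hc, Finset.card_univ,
    Fintype.card_fin, neg_pow y]
  ring

/-- Let `Q(y) = ∏ (ω_l^η - y)`. At `y = ω_j^η` the numerator is `Q(q y) - q^K Q(y)`, whose terms of
degree `K` cancel. Since `Q(y) = 0`, it equals `Q(q y)`, and its factor with `l = j` is `p y`. -/
lemma Admissible.coeff_eq (h : prm.Admissible) (j : Fin K) :
    prm.coeff j = tailCoeff prm.pTr (fun i => prm.ω i ^ prm.η) Finset.univ j := by
  have hpos : 0 < prm.ω j ^ prm.η := Real.rpow_pos_of_pos (h.ω_pos j) _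
  set y := prm.ω j ^ prm.η
  set q := 1 - prm.pTr
  have h1 := prm.sum_alpha_mul_pow (q * y)
  have h2 := prm.sum_alpha_mul_pow y
  rw [Finset.prod_eq_zero (Finset.mem_univ j) (sub_self _)] at h2
  have hnum : ∑ i ∈ Finset.range K, prm.alpha i * (q ^ i - q ^ K) * y ^ i
      = ∏ l, (prm.ω l ^ prm.η - q * y) := by
    rw [← h1, ← sub_zero (∑ i ∈ Finset.range (K + 1), prm.alpha i * (q * y) ^ i),
      ← mul_zero (q ^ K), ← h2, Finset.mul_sum, ← Finset.sum_sub_distrib, Finset.sum_range_succ]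
    have : prm.alpha K * (q * y) ^ K - q ^ K * (prm.alpha K * y ^ K) = 0 := by
      rw [mul_pow]; ring
    rw [this, add_zero]
    exact Finset.sum_congr rfl fun i _ => by rw [mul_pow]; ring
  rw [coeff, hnum, tailCoeff, Finset.prod_div_distrib,
    ← Finset.mul_prod_erase _ _ (Finset.mem_univ j)]
  have : prm.ω j ^ prm.η - q * y = prm.pTr * y := by simp only [y, q]; ring
  have hne : prm.ω j ^ prm.η ≠ 0 := hpos.ne'
  rw [this]
  simp only [y, q]
  field_simp

lemma Admissible.ω_le_one (h : prm.Admissible) (i : Fin K) : prm.ω i ≤ 1 := by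
  have hK := h.K_pos
  rw [← h.ω_last ⟨K - 1, by omega⟩ (by simp; omega)]
  exact h.ω_strictMono.monotone (Fin.le_def.2 (by simp; omega))

lemma Admissible.guard_iff (h : prm.Admissible) {r u : ℝ} (hr : 0 < r) :
    (∀ i, prm.ω i * r < u) ↔ r < u := by
  have hK := h.K_pos
  constructor
  · intro hi
    have := hi ⟨K - 1, by omega⟩
    rwa [h.ω_last ⟨K - 1, by omega⟩ (by simp; omega), one_mul] at this
  · intro hu i
    exact lt_of_le_of_lt (mul_le_of_le_one_left hr.le (h.ω_le_one i)) hu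

lemma Admissible.upsilon_nonneg (h : prm.Admissible) {θ : ℝ} (hθ : 0 ≤ θ) (j : Fin K) :
    0 ≤ prm.upsilon θ j := by
  have hη := h.η_gt
  have hη0 : 0 < prm.η := by linarith
  have h1 := Real.Gamma_nonneg_of_nonneg (by positivity : 0 ≤ 1 + 2 / prm.η)
  have h2 := Real.Gamma_nonneg_of_nonneg (by
    rw [sub_nonneg, div_le_one hη0]; exact hη.le : 0 ≤ 1 - 2 / prm.η)
  have h3 : 0 ≤ ∑ m, (prm.tierPTr m / prm.pTr) * (prm.tierDens m / prm.dens) *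
      prm.tierPow m ^ (2 / prm.η) := Finset.sum_nonneg fun m _ => by
    have := h.tierPTr_nonneg m
    have := h.tierDens_pos m
    have := h.tierPow_pos m
    have := h.pTr_pos
    have := h.dens_pos
    positivity
  unfold upsilon
  positivity

/-! ### Laplace exponent of the interference -/

/-- Path-loss weights of the tiers, for a guard zone of radius `r` in the transmitter tier. -/
def weight (prm : NetworkParams K M) (r : ℝ) : Fin (M + 1) → Plane → ℝ :=
  Fin.cons (fun x => if r < ‖x‖ then ‖x‖ ^ (-prm.η) else 0)
    fun m x => prm.tierPow m * ‖x‖ ^ (-prm.η)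

lemma measurable_weight (prm : NetworkParams K M) (r : ℝ) (m : Fin (M + 1)) :
    Measurable (prm.weight r m) := by
  refine Fin.cases ?_ (fun m => ?_) m
  · exact Measurable.ite (measurableSet_lt measurable_const measurable_norm) (by fun_prop)
      measurable_const
  · have : Measurable fun x : Plane => prm.tierPow m * ‖x‖ ^ (-prm.η) := by fun_prop
    exact this

lemma Admissible.weight_nonneg (h : prm.Admissible) (r : ℝ) (m : Fin (M + 1)) (x : Plane) :
    0 ≤ prm.weight r m x := by
  refine Fin.cases ?_ (fun m => ?_) m
  · simp only [weight, Fin.cons_zero]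
    split_ifs <;> positivity
  · have := (h.tierPow_pos m).le
    simp only [weight, Fin.cons_succ]
    positivity

/-- The Laplace exponent of the total interference. -/
lemma Admissible.laplace_exponent (h : prm.Admissible) {r θ : ℝ} (hr : 0 < r) (hθ : 0 ≤ θ)
    (j : Fin K) :
    ∑ m, ENNReal.ofReal (prm.allDens m) * (ENNReal.ofReal (prm.allPTr m) *
      ∫⁻ x, ENNReal.ofReal ((prm.ω j * r) ^ prm.η * θ * prm.weight r m x /
        (1 + (prm.ω j * r) ^ prm.η * θ * prm.weight r m x)))
    = ENNReal.ofReal (prm.pTr * prm.dens * Real.pi * r ^ 2 *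
        (hyperF (prm.ω j ^ prm.η * θ) prm.η + prm.upsilon θ j)) := by
  have hη := h.η_gt
  have hη0 : 0 < prm.η := by linarith
  have hω := h.ω_pos j
  have hp := h.pTr_pos
  have hdens := h.dens_pos
  have hpi := Real.pi_pos
  have ht : 0 ≤ prm.ω j ^ prm.η * θ := by positivity
  have hF := hyperF_nonneg hη ht
  have hU := h.upsilon_nonneg hθ j
  -- This brings the Laplace variable to the form `t * r ^ η` of the guarded integral, with `t =
  -- ω_j^η θ`.
  have hs : (prm.ω j * r) ^ prm.η * θ = prm.ω j ^ prm.η * θ * r ^ prm.η := by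
    rw [Real.mul_rpow hω.le hr.le]; ring
  have h0 : ∫⁻ x, ENNReal.ofReal ((prm.ω j * r) ^ prm.η * θ * prm.weight r 0 x /
        (1 + (prm.ω j * r) ^ prm.η * θ * prm.weight r 0 x))
      = ENNReal.ofReal (Real.pi * r ^ 2 * hyperF (prm.ω j ^ prm.η * θ) prm.η) := by
    rw [← lintegral_plane_guarded hη hr ht, hs]
    simp only [weight, Fin.cons_zero, mul_ite, mul_zero]
  have hm : ∀ m : Fin M, ∫⁻ x, ENNReal.ofReal ((prm.ω j * r) ^ prm.η * θ *
        prm.weight r m.succ x / (1 + (prm.ω j * r) ^ prm.η * θ * prm.weight r m.succ x))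
      = ENNReal.ofReal (Real.pi * ((((prm.ω j * r) ^ prm.η * θ) * prm.tierPow m) ^ (2 / prm.η) *
          Real.Gamma (1 + 2 / prm.η) * Real.Gamma (1 - 2 / prm.η))) := by
    intro m
    have := (h.tierPow_pos m).le
    rw [← lintegral_plane_unguarded hη (by positivity)]
    simp only [weight, Fin.cons_succ, mul_assoc]
  have hG1 := Real.Gamma_nonneg_of_nonneg (by positivity : 0 ≤ 1 + 2 / prm.η)
  have hG2 := Real.Gamma_nonneg_of_nonneg (by
    rw [sub_nonneg, div_le_one hη0]; exact hη.le : 0 ≤ 1 - 2 / prm.η)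
  rw [Fin.sum_univ_succ, h0]
  simp_rw [hm]
  simp only [allDens, allPTr, Fin.cons_zero, Fin.cons_succ]
  rw [← ENNReal.ofReal_mul hp.le, ← ENNReal.ofReal_mul hdens.le]
  -- The exponent `2/η` undoes the power `η`, so `(ω_j r)²` comes out and `r²` is common to all
  -- tiers; dividing by `p_tr λ` produces the ratios in `Υ_j`.
  have hterm : ∀ m, ENNReal.ofReal (prm.tierDens m) * (ENNReal.ofReal (prm.tierPTr m) *
      ENNReal.ofReal (Real.pi * ((((prm.ω j * r) ^ prm.η * θ) * prm.tierPow m) ^ (2 / prm.η) *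
          Real.Gamma (1 + 2 / prm.η) * Real.Gamma (1 - 2 / prm.η))))
      = ENNReal.ofReal (prm.pTr * prm.dens * Real.pi * r ^ 2 *
        (prm.ω j ^ 2 * θ ^ (2 / prm.η) * Real.Gamma (1 + 2 / prm.η) *
          Real.Gamma (1 - 2 / prm.η) * ((prm.tierPTr m / prm.pTr) *
          (prm.tierDens m / prm.dens) * prm.tierPow m ^ (2 / prm.η)))) := by
    intro m
    have hP := (h.tierPow_pos m).le
    rw [← ENNReal.ofReal_mul (h.tierPTr_nonneg m), ← ENNReal.ofReal_mul (h.tierDens_pos m).le,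
      Real.mul_rpow (by positivity) hP, Real.mul_rpow (by positivity) hθ,
      ← Real.rpow_mul (by positivity), mul_div_cancel₀ _ hη0.ne', Real.rpow_two]
    congr 1
    field_simp
  rw [Finset.sum_congr rfl fun m _ => hterm m, ← ENNReal.ofReal_sum_of_nonneg, ← Finset.mul_sum,
    ← Finset.mul_sum, ← ENNReal.ofReal_add (by positivity)]
  · congr 1
    rw [upsilon]
    ring
  · have : prm.ω j ^ 2 * θ ^ (2 / prm.η) * Real.Gamma (1 + 2 / prm.η) *
          Real.Gamma (1 - 2 / prm.η) * ∑ m, (prm.tierPTr m / prm.pTr) *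
          (prm.tierDens m / prm.dens) * prm.tierPow m ^ (2 / prm.η) = prm.upsilon θ j := rfl
    rw [this]
    positivity
  · intro m _
    have := h.tierPTr_nonneg m
    have := h.tierDens_pos m
    have := h.tierPow_pos m
    positivity

end NetworkParams

/-! ### Coverage probability at a fixed cluster radius -/

namespace Network

variable {Ω : Type*} {K M : ℕ} {N : Network Ω K M} {prm : NetworkParams K M}

lemma ofReal_mul_interference {s : ℝ} (hs : 0 ≤ s) (W : Fin (M + 1) → Plane → ℝ) (w : Ω) :
    ENNReal.ofReal s * N.interference W w = N.interference (fun m x => s * W m x) w := by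
  simp only [interference, Finset.mul_sum, ← ENNReal.tsum_mul_left, mul_ite, mul_zero,
    ← ENNReal.ofReal_mul hs, mul_assoc]

lemma intrinsic_add_extrinsic (hprm : prm.Admissible) {r : ℝ} (hr : 0 < r) (w : Ω) :
    N.intrinsic prm.η (fun i => prm.ω i * r) w + N.extrinsic prm w
      = N.interference (prm.weight r) w := by
  rw [interference, Fin.sum_univ_succ, intrinsic, extrinsic]
  congr 1
  refine tsum_congr fun n => ?_
  simp only [hprm.guard_iff hr, NetworkParams.weight, Fin.cons_zero]
  by_cases h1 : N.on 0 n w = true <;> by_cases h2 : r < ‖N.points 0 n w‖ <;> simp [h1, h2]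

namespace IsModel

variable [MeasurableSpace Ω] {P : Measure Ω}

lemma measurable_interference (hN : N.IsModel P prm) {W : Fin (M + 1) → Plane → ℝ}
    (hW : ∀ m, Measurable (W m)) : Measurable (N.interference W) :=
  Network.measurable_interference (fun m => (hN.points_law m).measurable) hN.measurable_on
    hN.measurable_fading hW

/-- The interference is almost surely finite as soon as its Laplace exponent is. -/
lemma ae_interference_ne_top [IsProbabilityMeasure P] (hN : N.IsModel P prm)
    (hprm : prm.Admissible) {W : Fin (M + 1) → Plane → ℝ} (hW : ∀ m, Measurable (W m))
    (hW0 : ∀ m x, 0 ≤ W m x) (hfin : ∀ m, ∫⁻ x, ENNReal.ofReal (W m x / (1 + W m x)) ≠ ⊤) :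
    ∀ᵐ w ∂P, N.interference W w ≠ ⊤ := by
  have hIm := hN.measurable_interference hW
  -- The Laplace variable tends to 0: `E[exp(-s I)]` then tends to 1 by dominated convergence of the
  -- exponent, while for every `s > 0` it is at most `P(I < ∞)`.
  set s : ℕ → ℝ := fun n => 1 / ((n : ℝ) + 1)
  have hs : ∀ n, 0 < s n := fun n => by simp only [s]; positivity
  have hs1 : ∀ n, s n ≤ 1 := fun n => by
    simp only [s]
    rw [div_le_one (by positivity)]
    have : (0 : ℝ) ≤ n := Nat.cast_nonneg n
    linarith
  have hlim : ∀ m, Tendsto (fun n => ∫⁻ x, ENNReal.ofReal (s n * W m x / (1 + s n * W m x)))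
      atTop (𝓝 0) := by
    intro m
    have hcont : ∀ x, Tendsto (fun n => ENNReal.ofReal (s n * W m x / (1 + s n * W m x))) atTop
        (𝓝 0) := by
      intro x
      have h1 : Tendsto (fun n => s n * W m x) atTop (𝓝 0) := by
        simpa [s] using tendsto_one_div_add_atTop_nhds_zero_nat.mul_const (W m x)
      have h2 := h1.div (h1.const_add 1) (by norm_num)
      simpa using ENNReal.tendsto_ofReal h2
    have := tendsto_lintegral_of_dominated_convergence (μ := (volume : Measure Plane))
      (F := fun n x => ENNReal.ofReal (s n * W m x / (1 + s n * W m x))) (f := fun _ => 0)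
      (fun x => ENNReal.ofReal (W m x / (1 + W m x)))
      (fun n => (((hW m).const_mul _).div
        (measurable_const.add ((hW m).const_mul _))).ennreal_ofReal)
      (fun n => Eventually.of_forall fun x => ?_) (hfin m) (Eventually.of_forall hcont)
    · simpa using this
    · refine ENNReal.ofReal_le_ofReal ?_
      have hw := hW0 m x
      have hsn := (hs n).le
      rw [div_le_div_iff₀ (by positivity) (by positivity)]
      nlinarith [mul_le_mul_of_nonneg_right (hs1 n) hw]
  have hlim2 : Tendsto (fun n => expNeg (∑ m, ENNReal.ofReal (prm.allDens m) *
      (ENNReal.ofReal (prm.allPTr m) *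
        ∫⁻ x, ENNReal.ofReal (s n * W m x / (1 + s n * W m x))))) atTop (𝓝 1) := by
    rw [← expNeg_zero]
    refine (continuous_expNeg.tendsto _).comp ?_
    rw [← Finset.sum_const_zero (s := (Finset.univ : Finset (Fin (M + 1))))]
    refine tendsto_finsetSum _ fun m _ => ?_
    have h1 := ENNReal.Tendsto.const_mul (a := ENNReal.ofReal (prm.allPTr m)) (hlim m)
      (Or.inr ENNReal.ofReal_ne_top)
    have h2 := ENNReal.Tendsto.const_mul (a := ENNReal.ofReal (prm.allDens m)) h1
      (Or.inr ENNReal.ofReal_ne_top)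
    simpa using h2
  have hmeas : MeasurableSet {w | N.interference W w ≠ ⊤} :=
    (hIm (measurableSet_singleton ⊤)).compl
  refine mem_ae_iff.2 ((prob_compl_eq_zero_iff hmeas).2
    (le_antisymm prob_le_one (le_of_tendsto' hlim2 fun n => ?_)))
  rw [← hN.laplace_interference hprm (W := fun m x => s n * W m x)
    (fun m => (hW m).const_mul _) (fun m x => mul_nonneg (hs n).le (hW0 m x)),
    ← lintegral_indicator_one hmeas]
  refine lintegral_mono fun w => ?_
  rw [← ofReal_mul_interference (hs n).le]
  by_cases hw : N.interference W w = ⊤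
  · simp [hw, ENNReal.mul_top, hs n]
  · simp only [Set.indicator, Set.mem_ofPred_eq, ne_eq, hw, not_false_eq_true, if_true,
      Pi.one_apply]
    exact expNeg_le_one _

/-- The interference is measurable with respect to all sources other than the marks of the serving
transmitters. -/
lemma indepFun_interference_signal (hN : N.IsModel P prm) {W : Fin (M + 1) → Plane → ℝ}
    (hW : ∀ m, Measurable (W m)) (η : ℝ) (d : Fin K → ℝ) :
    IndepFun (N.interference W) (N.partialSignal η d Finset.univ) P := by
  refine hN.indepFun (T := clusterSources (Finset.univ : Finset (Fin K)))
    (S := (clusterSources (Finset.univ : Finset (Fin K)))ᶜ) disjoint_compl_left ?_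
    (measurable_partialSignal_sigmaOf η d _)
  refine @Network.measurable_interference _ _ _ N (N.sigmaOf _) (fun m n => ?_) (fun m n => ?_)
    (fun m n => ?_) _ hW
  · exact measurable_points_sigmaOf (by simp [clusterSources])
  · exact measurable_on_sigmaOf (by simp [clusterSources])
  · exact measurable_fading_sigmaOf (by simp [clusterSources])

/-- The coverage probability for a fixed distance `r` to the farthest serving transmitter. -/
theorem linkCCDF_eq [IsProbabilityMeasure P] (hN : N.IsModel P prm) (hprm : prm.Admissible)
    {r θ σ2 : ℝ} (hr : 0 < r) (hθ : 0 ≤ θ) (hσ : 0 ≤ σ2) :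
    (N.linkCCDF P prm σ2 (fun i => prm.ω i * r) θ).toReal
      = ∑ j, prm.coeff j * (Real.exp (-((prm.ω j * r) ^ prm.η * θ * σ2)) *
          Real.exp (-(prm.pTr * prm.dens * Real.pi * r ^ 2 *
            (hyperF (prm.ω j ^ prm.η * θ) prm.η + prm.upsilon θ j)))) := by
  have hη0 : 0 < prm.η := by linarith [hprm.η_gt]
  have hd : ∀ i, 0 < prm.ω i * r := fun i => mul_pos (hprm.ω_pos i) hr
  have hinj : Function.Injective fun i => (prm.ω i * r) ^ prm.η := by
    intro i j hij
    have h1 := Real.rpow_left_injOn hη0.ne' (hd i).le (hd j).le hij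
    exact hprm.ω_strictMono.injective (mul_right_cancel₀ hr.ne' h1)
  have hcoeff : ∀ j, tailCoeff prm.pTr (fun i => (prm.ω i * r) ^ prm.η) Finset.univ j
      = prm.coeff j := by
    intro j
    rw [hprm.coeff_eq, ← tailCoeff_const_mul prm.pTr
      (fun i => prm.ω i ^ prm.η) Finset.univ j (Real.rpow_pos_of_pos hr prm.η).ne']
    congr 1
    ext i
    exact Real.mul_rpow (hprm.ω_pos i).le hr.le
  have hWm := prm.measurable_weight r
  have hW0 := hprm.weight_nonneg r
  have hIm := hN.measurable_interference hWm
  have hSm := hN.measurable_partialSignal prm.η (fun i => prm.ω i * r) Finset.univ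
  set I := N.interference (prm.weight r)
  set S := N.partialSignal prm.η (fun i => prm.ω i * r) Finset.univ
  -- Laplace transforms of the interference
  have hlap : ∀ j, ∫⁻ w, expNeg (ENNReal.ofReal ((prm.ω j * r) ^ prm.η * θ) * I w) ∂P
      = ENNReal.ofReal (Real.exp (-(prm.pTr * prm.dens * Real.pi * r ^ 2 *
            (hyperF (prm.ω j ^ prm.η * θ) prm.η + prm.upsilon θ j)))) := by
    intro j
    have hs : 0 ≤ (prm.ω j * r) ^ prm.η * θ := mul_nonneg (Real.rpow_nonneg (hd j).le _) hθ
    simp_rw [I, ofReal_mul_interference hs]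
    rw [hN.laplace_interference hprm (fun m => (hWm m).const_mul _)
      (fun m x => mul_nonneg hs (hW0 m x)), hprm.laplace_exponent hr hθ j, expNeg_ofReal]
    have hF := hyperF_nonneg hprm.η_gt
      (mul_nonneg (Real.rpow_nonneg (hprm.ω_pos j).le prm.η) hθ)
    have hU := hprm.upsilon_nonneg hθ j
    have := hprm.pTr_pos
    have := hprm.dens_pos
    have := Real.pi_pos
    positivity
  have hIfin : ∀ᵐ w ∂P, I w ≠ ⊤ := by
    refine hN.ae_interference_ne_top hprm hWm hW0 fun m => ?_
    refine Fin.cases ?_ (fun m => ?_) m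
    -- The choice `t = r^(-η)` makes `t * r ^ η = 1`, which is the unscaled weight.
    · have h1 := lintegral_plane_guarded hprm.η_gt hr (inv_nonneg.2 (Real.rpow_nonneg hr.le prm.η))
      rw [inv_mul_cancel₀ (Real.rpow_pos_of_pos hr _).ne'] at h1
      simp only [one_mul] at h1
      exact (h1.trans_lt ENNReal.ofReal_lt_top).ne
    · exact ((lintegral_plane_unguarded hprm.η_gt (hprm.tierPow_pos m).le).trans_lt
        ENNReal.ofReal_lt_top).ne
  -- Almost sure finiteness of `I` matters at `θ = 0`: there `0 * ⊤ = 0` would put `I = ⊤`, `S > 0`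
  -- in the right-hand event although the ratio is 0 for finite `S`.
  have hset : P {w | ENNReal.ofReal θ < N.sinr prm σ2 (fun i => prm.ω i * r) w}
      = P {w | ENNReal.ofReal θ * (I w + ENNReal.ofReal σ2) < S w} := by
    refine measure_congr ?_
    filter_upwards [hIfin] with w hw
    have hT : I w + ENNReal.ofReal σ2 ≠ ⊤ := ENNReal.add_ne_top.2 ⟨hw, ENNReal.ofReal_ne_top⟩
    have hsinr : N.sinr prm σ2 (fun i => prm.ω i * r) w
        = S w / (I w + ENNReal.ofReal σ2) := by
      rw [sinr, intrinsic_add_extrinsic hprm hr]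
      rfl
    refine propext ?_
    change ENNReal.ofReal θ < N.sinr prm σ2 (fun i => prm.ω i * r) w ↔
      ENNReal.ofReal θ * (I w + ENNReal.ofReal σ2) < S w
    rw [hsinr]
    -- With a zero denominator, `S / 0 = ⊤` for `S > 0` and `0 / 0 = 0`, so both sides say `S > 0`.
    by_cases hz : I w + ENNReal.ofReal σ2 = 0
    · rw [hz, mul_zero]
      by_cases hS : S w = 0
      · simp [hS]
      · simp [ENNReal.div_zero hS, pos_iff_ne_zero.2 hS]
    · exact ENNReal.lt_div_iff_mul_lt (Or.inl hz) (Or.inl hT)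
  -- conditioning on the interference
  have hcond : P {w | ENNReal.ofReal θ * (I w + ENNReal.ofReal σ2) < S w}
      = ∫⁻ w, P {w' | ENNReal.ofReal θ * (I w + ENNReal.ofReal σ2) < S w'} ∂P := by
    have hset' : MeasurableSet {q : ℝ≥0∞ × ℝ≥0∞ |
        ENNReal.ofReal θ * (q.1 + ENNReal.ofReal σ2) < q.2} :=
      measurableSet_lt (by fun_prop) measurable_snd
    have h1 := lintegral_comp_indepFun hIm hSm
      (hN.indepFun_interference_signal hWm prm.η fun i => prm.ω i * r)
      (F := Set.indicator {q | ENNReal.ofReal θ * (q.1 + ENNReal.ofReal σ2) < q.2} 1)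
      (measurable_one.indicator hset')
    rw [← lintegral_indicator_one (measurableSet_lt (by fun_prop) hSm)]
    refine h1.trans (lintegral_congr fun w => ?_)
    rw [← lintegral_indicator_one (measurableSet_lt measurable_const hSm)]
    rfl
  -- The signal tail at level `θ (I + σ²)` splits into a noise factor and the integrand of a Laplace
  -- transform of `I`.
  have htail : ∀ᵐ w ∂P, P.real {w' | ENNReal.ofReal θ * (I w + ENNReal.ofReal σ2) < S w'}
      = (∑ j, prm.coeff j * (Real.exp (-((prm.ω j * r) ^ prm.η * θ * σ2)) *
          (expNeg (ENNReal.ofReal ((prm.ω j * r) ^ prm.η * θ) * I w)).toReal)) := by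
    filter_upwards [hIfin] with w hw
    have h1 : ENNReal.ofReal θ * (I w + ENNReal.ofReal σ2)
        = ENNReal.ofReal (θ * ((I w).toReal + σ2)) := by
      rw [ENNReal.ofReal_mul hθ, ENNReal.ofReal_add ENNReal.toReal_nonneg hσ,
        ENNReal.ofReal_toReal hw]
    have h0 : 0 ≤ θ * ((I w).toReal + σ2) :=
      mul_nonneg hθ (add_nonneg ENNReal.toReal_nonneg hσ)
    rw [h1]
    refine (hN.signal_tail hprm hd hinj Finset.univ h0).trans ?_
    refine Finset.sum_congr rfl fun j _ => ?_
    have hs : 0 ≤ (prm.ω j * r) ^ prm.η * θ := mul_nonneg (Real.rpow_nonneg (hd j).le _) hθ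
    rw [hcoeff]
    congr 1
    rw [← ENNReal.ofReal_toReal hw, ← ENNReal.ofReal_mul hs,
      expNeg_ofReal (mul_nonneg hs ENNReal.toReal_nonneg), ENNReal.toReal_ofReal
      (Real.exp_pos _).le, ← Real.exp_add, ENNReal.toReal_ofReal ENNReal.toReal_nonneg]
    congr 1
    ring
  have hEm : ∀ j, Measurable fun w =>
      (expNeg (ENNReal.ofReal ((prm.ω j * r) ^ prm.η * θ) * I w)).toReal :=
    fun j => (measurable_expNeg.comp (hIm.const_mul _)).ennreal_toReal
  have hEi : ∀ j, Integrable (fun w =>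
      (expNeg (ENNReal.ofReal ((prm.ω j * r) ^ prm.η * θ) * I w)).toReal) P := by
    intro j
    refine Integrable.of_bound (hEm j).aestronglyMeasurable 1 (Eventually.of_forall fun w => ?_)
    rw [Real.norm_of_nonneg ENNReal.toReal_nonneg]
    exact ENNReal.toReal_le_of_le_ofReal zero_le_one (by simpa using expNeg_le_one _)
  have hsum : Integrable (fun w => ∑ j, prm.coeff j *
      (Real.exp (-((prm.ω j * r) ^ prm.η * θ * σ2)) *
        (expNeg (ENNReal.ofReal ((prm.ω j * r) ^ prm.η * θ) * I w)).toReal)) P :=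
    integrable_finsetSum _ fun j _ => ((hEi j).const_mul _).const_mul _
  have htail' : ∀ᵐ w ∂P, P {w' | ENNReal.ofReal θ * (I w + ENNReal.ofReal σ2) < S w'}
      = ENNReal.ofReal (∑ j, prm.coeff j * (Real.exp (-((prm.ω j * r) ^ prm.η * θ * σ2)) *
          (expNeg (ENNReal.ofReal ((prm.ω j * r) ^ prm.η * θ) * I w)).toReal)) := by
    filter_upwards [htail] with w hw
    rw [← hw, Measure.real, ENNReal.ofReal_toReal (measure_ne_top P _)]
  -- Individual coefficients may be negative, so the sum is integrated over the reals; it is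
  -- nonnegative as a whole because it is a probability.
  have hnonneg : 0 ≤ᵐ[P] fun w => ∑ j, prm.coeff j *
      (Real.exp (-((prm.ω j * r) ^ prm.η * θ * σ2)) *
        (expNeg (ENNReal.ofReal ((prm.ω j * r) ^ prm.η * θ) * I w)).toReal) := by
    filter_upwards [htail] with w hw
    rw [← hw]
    exact measureReal_nonneg
  rw [linkCCDF, hset, hcond, lintegral_congr_ae htail',
    ← ofReal_integral_eq_lintegral_ofReal hsum hnonneg,
    ENNReal.toReal_ofReal (integral_nonneg_of_ae hnonneg),
    integral_finsetSum _ fun j _ => ((hEi j).const_mul _).const_mul _]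
  refine Finset.sum_congr rfl fun j _ => ?_
  rw [integral_const_mul, integral_const_mul, integral_toReal
    (f := fun w => expNeg (ENNReal.ofReal ((prm.ω j * r) ^ prm.η * θ) * I w))
    (measurable_expNeg.comp (hIm.const_mul _)).aemeasurable
    (Eventually.of_forall fun w => (expNeg_le_one _).trans_lt ENNReal.one_lt_top), hlap,
    ENNReal.toReal_ofReal (Real.exp_pos _).le]

end IsModel

end Network

/-! ### Averaging over the cluster radius -/

lemma IsHomogeneousPPP.ae_kthNearest_pos {Ω : Type*} [MeasurableSpace Ω] {P : Measure Ω}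
    [IsProbabilityMeasure P] {X : ℕ → Ω → Plane} {ρ : ℝ} (h : IsHomogeneousPPP P X ρ)
    (hρ : 0 < ρ) {K : ℕ} (hK : 0 < K) : ∀ᵐ w ∂P, 0 < kthNearest K fun n => X n w := by
  have h1 : P.map (fun w => kthNearest K fun n => X n w) (Set.Iic 0) = 0 := by
    rw [h.map_kthNearest hρ hK, withDensity_apply _ measurableSet_Iic,
      setLIntegral_distDensity hK hρ le_rfl]
    simp [poissonTail_zero hK]
  rw [Measure.map_apply (h.measurable_kthNearest K) measurableSet_Iic] at h1
  rw [ae_iff]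
  simp only [not_lt]
  exact h1

namespace Network.IsModel

variable {Ω Ω' : Type*} [MeasurableSpace Ω] [MeasurableSpace Ω'] {K M : ℕ} {N : Network Ω K M}
  {prm : NetworkParams K M} {P : Measure Ω} [IsProbabilityMeasure P] {P' : Measure Ω'}
  [IsProbabilityMeasure P'] {Y : ℕ → Ω' → Plane}

/-- Measurability of the coverage probability in the radius comes from the explicit formula, which
agrees with it at every positive radius, hence almost surely. -/
lemma avgCCDF_eq_integral (hN : N.IsModel P prm) (hprm : prm.Admissible)
    (hY : IsHomogeneousPPP P' Y (prm.pTr * prm.dens)) {θ σ2 : ℝ} (hθ : 0 ≤ θ) (hσ : 0 ≤ σ2) :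
    N.avgCCDF P prm Y P' σ2 θ
      = ∫ w', (N.linkCCDF P prm σ2
          (fun i => prm.ω i * kthNearest K fun n => Y n w') θ).toReal ∂P' := by
  have hpos := hY.ae_kthNearest_pos (mul_pos hprm.pTr_pos hprm.dens_pos) hprm.K_pos
  have hdm := hY.measurable_kthNearest K
  have hfin : ∀ w', N.linkCCDF P prm σ2
      (fun i => prm.ω i * kthNearest K fun n => Y n w') θ ≠ ⊤ := fun w' => measure_ne_top P _
  rw [avgCCDF, integral_toReal _ (Eventually.of_forall fun w' => (hfin w').lt_top)]
  refine ⟨fun w' => ENNReal.ofReal (∑ j, prm.coeff j *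
    (Real.exp (-((prm.ω j * kthNearest K fun n => Y n w') ^ prm.η * θ * σ2)) *
      Real.exp (-(prm.pTr * prm.dens * Real.pi * (kthNearest K fun n => Y n w') ^ 2 *
        (hyperF (prm.ω j ^ prm.η * θ) prm.η + prm.upsilon θ j))))), by fun_prop, ?_⟩
  filter_upwards [hpos] with w' hw'
  rw [← hN.linkCCDF_eq hprm hw' hθ hσ, ENNReal.ofReal_toReal (hfin w')]

/-- The closed form in the absence of noise. -/
theorem avgCCDF_zero (hN : N.IsModel P prm) (hprm : prm.Admissible)
    (hY : IsHomogeneousPPP P' Y (prm.pTr * prm.dens)) {θ : ℝ} (hθ : 0 ≤ θ) :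
    N.avgCCDF P prm Y P' 0 θ = prm.closedForm θ := by
  have hρ := mul_pos hprm.pTr_pos hprm.dens_pos
  have hpos := hY.ae_kthNearest_pos hρ hprm.K_pos
  have hdm := hY.measurable_kthNearest K
  set C : Fin K → ℝ := fun j => hyperF (prm.ω j ^ prm.η * θ) prm.η + prm.upsilon θ j
  have hC : ∀ j, 0 ≤ C j := fun j => add_nonneg
    (hyperF_nonneg hprm.η_gt (mul_nonneg (Real.rpow_nonneg (hprm.ω_pos j).le prm.η) hθ))
    (hprm.upsilon_nonneg hθ j)
  set E : Fin K → ℝ → ℝ := fun j r => Real.exp (-(prm.pTr * prm.dens * Real.pi * r ^ 2 * C j))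
  have hEm : ∀ j, Measurable (E j) := fun j => by simp only [E]; fun_prop
  have hEi : ∀ j, Integrable (fun w' => E j (kthNearest K fun n => Y n w')) P' := by
    intro j
    refine Integrable.of_bound ((hEm j).comp hdm).aestronglyMeasurable 1
      (Eventually.of_forall fun w' => ?_)
    rw [Real.norm_of_nonneg (Real.exp_pos _).le]
    refine Real.exp_le_one_iff.2 (neg_nonpos.2 ?_)
    have := hC j
    have := Real.pi_pos
    positivity
  have hE : ∀ j, ∫ w', E j (kthNearest K fun n => Y n w') ∂P' = ((1 + C j) ^ K)⁻¹ := by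
    intro j
    rw [← integral_exp_withDensity_distDensity hprm.K_pos hρ (hC j),
      ← hY.map_kthNearest hρ hprm.K_pos, integral_map hdm.aemeasurable
        (hEm j).aestronglyMeasurable]
  have hae : (fun w' => (N.linkCCDF P prm 0
        (fun i => prm.ω i * kthNearest K fun n => Y n w') θ).toReal)
      =ᵐ[P'] fun w' => ∑ j, prm.coeff j * E j (kthNearest K fun n => Y n w') := by
    filter_upwards [hpos] with w' hw'
    rw [hN.linkCCDF_eq hprm hw' hθ le_rfl]
    simp only [mul_zero, neg_zero, Real.exp_zero, one_mul, E, C]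
  rw [hN.avgCCDF_eq_integral hprm hY hθ le_rfl, integral_congr_ae hae,
    integral_finsetSum _ fun j _ => (hEi j).const_mul _, NetworkParams.closedForm]
  refine Finset.sum_congr rfl fun j _ => ?_
  rw [integral_const_mul, hE j, add_assoc]

/-- Continuity of the averaged CCDF as the noise vanishes. -/
theorem tendsto_avgCCDF (hN : N.IsModel P prm) (hprm : prm.Admissible)
    (hY : IsHomogeneousPPP P' Y (prm.pTr * prm.dens)) {θ : ℝ} (hθ : 0 ≤ θ) :
    Tendsto (fun σ2 : ℝ => N.avgCCDF P prm Y P' σ2 θ) (𝓝[>] 0) (𝓝 (prm.closedForm θ)) := by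
  have hpos := hY.ae_kthNearest_pos (mul_pos hprm.pTr_pos hprm.dens_pos) hprm.K_pos
  have hdm := hY.measurable_kthNearest K
  rw [← hN.avgCCDF_zero hprm hY hθ, hN.avgCCDF_eq_integral hprm hY hθ le_rfl]
  have hev : ∀ᶠ σ2 : ℝ in 𝓝[>] 0, 0 ≤ σ2 :=
    eventually_nhdsWithin_of_forall fun _ h => le_of_lt h
  refine Tendsto.congr' (f₁ := fun σ2 => ∫ w', (N.linkCCDF P prm σ2
    (fun i => prm.ω i * kthNearest K fun n => Y n w') θ).toReal ∂P') ?_ ?_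
  · filter_upwards [hev] with σ2 hσ
    exact (hN.avgCCDF_eq_integral hprm hY hθ hσ).symm
  -- Probabilities are dominated by 1, and at each positive radius the explicit finite sum is
  -- continuous in the noise.
  refine tendsto_integral_filter_of_dominated_convergence (fun _ => 1) ?_ ?_
    (integrable_const _) ?_
  · filter_upwards [hev] with σ2 hσ
    refine AEMeasurable.aestronglyMeasurable ⟨fun w' => ∑ j, prm.coeff j *
      (Real.exp (-((prm.ω j * kthNearest K fun n => Y n w') ^ prm.η * θ * σ2)) *
        Real.exp (-(prm.pTr * prm.dens * Real.pi * (kthNearest K fun n => Y n w') ^ 2 *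
          (hyperF (prm.ω j ^ prm.η * θ) prm.η + prm.upsilon θ j)))), by fun_prop, ?_⟩
    filter_upwards [hpos] with w' hw'
    exact hN.linkCCDF_eq hprm hw' hθ hσ
  · refine Eventually.of_forall fun σ2 => Eventually.of_forall fun w' => ?_
    rw [Real.norm_of_nonneg ENNReal.toReal_nonneg]
    exact ENNReal.toReal_le_of_le_ofReal zero_le_one (by rw [ENNReal.ofReal_one]; exact prob_le_one)
  · filter_upwards [hpos] with w' hw'
    rw [hN.linkCCDF_eq hprm hw' hθ le_rfl]
    set r := kthNearest K fun n => Y n w'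
    have hc : Continuous fun σ2 : ℝ => ∑ j, prm.coeff j *
      (Real.exp (-((prm.ω j * r) ^ prm.η * θ * σ2)) *
        Real.exp (-(prm.pTr * prm.dens * Real.pi * r ^ 2 *
          (hyperF (prm.ω j ^ prm.η * θ) prm.η + prm.upsilon θ j)))) := by fun_prop
    refine ((hc.tendsto 0).mono_left nhdsWithin_le_nhds).congr' ?_
    filter_upwards [hev] with σ2 hσ
    exact (hN.linkCCDF_eq hprm hw' hθ hσ).symm

end Network.IsModel

/-! ### Independence of the transmitter density, and the theorem -/

lemma NetworkParams.Admissible.with_dens {K M : ℕ} {prm : NetworkParams K M}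
    (h : prm.Admissible) {dens₁ : ℝ} (hd : 0 < dens₁) :
    ({ prm with dens := dens₁ } : NetworkParams K M).Admissible :=
  { h with dens_pos := hd }

/-- The density occurs only in the sum over extrinsic tiers, which is empty here. -/
lemma NetworkParams.closedForm_with_dens {K : ℕ} (prm : NetworkParams K 0) (dens₁ θ : ℝ) :
    ({ prm with dens := dens₁ } : NetworkParams K 0).closedForm θ = prm.closedForm θ := by
  have h : ∀ j, ({ prm with dens := dens₁ } : NetworkParams K 0).upsilon θ j
      = prm.upsilon θ j := fun j => by
    simp [NetworkParams.upsilon]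
  simp only [NetworkParams.closedForm, h]
  rfl

end

theorem theorem2 {K M : ℕ} (prm : NetworkParams K M) (hprm : prm.Admissible)
    {Ω Ω' : Type*} [MeasurableSpace Ω] [MeasurableSpace Ω']
    (P : Measure Ω) [IsProbabilityMeasure P] (P' : Measure Ω') [IsProbabilityMeasure P']
    (N : Network Ω K M) (hN : N.IsModel P prm)
    (Y : ℕ → Ω' → Plane) (hY : IsHomogeneousPPP P' Y (prm.pTr * prm.dens)) :
    -- the law of the distance to the `K`-th nearest transmitter
    P'.map (fun w' => kthNearest K (fun n => Y n w')) =
        volume.withDensity (fun r => ENNReal.ofReal (distDensity K (prm.pTr * prm.dens) r)) ∧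
    ∀ θ : ℝ, 0 ≤ θ →
      -- the closed form without noise and in the limit of vanishing noise
      N.avgCCDF P prm Y P' 0 θ = prm.closedForm θ ∧
      Filter.Tendsto (fun σ2 : ℝ => N.avgCCDF P prm Y P' σ2 θ)
        (nhdsWithin 0 (Set.Ioi 0)) (nhds (prm.closedForm θ)) ∧
      -- without extrinsic tiers, the CCDF is the same for every other transmitter density
      (M = 0 → ∀ dens₁ : ℝ, 0 < dens₁ →
        ∀ {Ω₁ Ω₁' : Type*} [MeasurableSpace Ω₁] [MeasurableSpace Ω₁']
          (P₁ : Measure Ω₁) [IsProbabilityMeasure P₁]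
          (P₁' : Measure Ω₁') [IsProbabilityMeasure P₁']
          (N₁ : Network Ω₁ K M) (_ : N₁.IsModel P₁ { prm with dens := dens₁ })
          (Y₁ : ℕ → Ω₁' → Plane) (_ : IsHomogeneousPPP P₁' Y₁ (prm.pTr * dens₁)),
          N₁.avgCCDF P₁ { prm with dens := dens₁ } Y₁ P₁' 0 θ = N.avgCCDF P prm Y P' 0 θ) := by
  have hρ := mul_pos hprm.pTr_pos hprm.dens_pos
  refine ⟨hY.map_kthNearest hρ hprm.K_pos, fun θ hθ => ⟨hN.avgCCDF_zero hprm hY hθ,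
    hN.tendsto_avgCCDF hprm hY hθ, ?_⟩⟩
  intro hM dens₁ hdens₁ Ω₁ Ω₁' _ _ P₁ _ P₁' _ N₁ hN₁ Y₁ hY₁
  subst hM
  rw [hN.avgCCDF_zero hprm hY hθ, hN₁.avgCCDF_zero (hprm.with_dens hdens₁) hY₁ hθ,
    prm.closedForm_with_dens]
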